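/- Let $\mathbb{T}\subseteq\mathbb{R}$ be a time scale (a nonempty closed set), let $a,b\in\mathbb{T}$ with $a<b$, and put $I=\mathbb{T}\cap[a,b]$. For a compact time scale $S$ let $\sigma,\rho$ be its forward and backward jump operators (with $\sigma(\max S)=\max S$, $\rho(\min S)=\min S$), $S^{\kappa}=S\setminus(\rho(\max S),\max S]$, $S_{\kappa}=S\setminus[\min S,\sigma(\min S))$ and $S^{\kappa^2}=(S^{\kappa})^{\kappa}$; $\sigma$, $\rho$, $y^\sigma=y\circ\sigma$, $y^\rho=y\circ\rho$, $y^\Delta$, $y^\nabla$ and $\Delta t$ refer to the time scale $I$. Let $L,g:\mathbb{T}\times\mathbb{R}^2\to\mathbb{R}$, $(t,x,v)\mapsto L(t,x,v),\,g(t,x,v)$, be smooth, in the sense that each is continuous and has continuous partial derivatives $\partial_2$ and $\partial_3$ with respect to $x$ and $v$ on $\mathbb{T}\times\mathbb{R}^2$. Let $y_a,y_b,l\in\mathbb{R}$. Call $y:I\to\mathbb{R}$ admissible if $y^\Delta$ exists and is continuous on $I^\kappa$, $y(a)=y_a$, $y(b)=y_b$, and $$\int_a^b g(t,y^\sigma(t),y^\Delta(t))\,\Delta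 t=l .$$ Suppose that $\hat y$ is a local minimizer of $$J(y)=\int_a^b L(t,y^\sigma(t),y^\Delta(t))\,\Delta t$$ among the admissible functions, that is, $\hat y$ is admissible and there is $\delta>0$ such that $J(\hat y)\le J(y)$ for every admissible $y$ with $\|y-\hat y\|_{1,\infty}<\delta$, where $\|y\|_{1,\infty}=\|y^\sigma\|_\infty+\|y^\rho\|_\infty+\|y^\Delta\|_\infty+\|y^\nabla\|_\infty$ and $\|f\|_\infty=\sup_{t\in I^\kappa\cap I_\kappa}|f(t)|$. Suppose also that $\hat y$ is normal, i.e. not an extremal of the constraint functional: with $$E(t)=\partial_3 g(t,\hat y^\sigma(t),\hat y^\Delta(t))-\int_a^t\partial_2 g(\tau,\hat y^\sigma(\tau),\hat y^\Delta(\tau))\,\Delta\tau ,$$ it is not the case that both $E(\rho(t))$ is constant for $t\in I_\kappa$ and $E(t)$ is constant for $t\in I^\kappa$. Then there is $\lambda\in\mathbb{R}$ such that, with $F(t,x,v)=L(t,x,v)-\lambda g(t,x,v)$, the function $t\mapsto\partial_3F(t,\hat y^\sigma(t),\hat y^\Delta(t))$, which is defined on the time scale $I^\kappa$, is delta differentiable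 with $$\frac{\Delta}{\Delta t}\bigl[\partial_3F(t,\hat y^\sigma(t),\hat y^\Delta(t))\bigr]-\partial_2F(t,\hat y^\sigma(t),\hat y^\Delta(t))=0$$ at every $t\in I^{\kappa^2}$ with $\sigma(t)\in I^\kappa$. (The condition $\sigma(t)\in I^\kappa$ holds for every $t\in I^{\kappa^2}$, unless $\rho(b)<b$ and $\rho(b)$ is a limit of points of $I$ from the left, in which case it excludes exactly the point $t=\rho(b)$.) -/

import Mathlib

open Set MeasureTheory

namespace TimeScale

noncomputable section

/-! ### Calculus on a time scale `S ⊆ ℝ` (a nonempty closed set of reals)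

Functions on a time scale are represented by functions `ℝ → ℝ`; only their values on the
time scale matter. -/

open Classical in
/-- The forward jump operator: `σ(t) = inf {s ∈ S : s > t}`, and `σ(t) = t` if `t = max S`. -/
def sigma (S : Set ℝ) (t : ℝ) : ℝ :=
  if (S ∩ Ioi t).Nonempty then sInf (S ∩ Ioi t) else t

open Classical in
/-- The backward jump operator: `ρ(t) = sup {s ∈ S : s < t}`, and `ρ(t) = t` if `t = min S`. -/
def rho (S : Set ℝ) (t : ℝ) : ℝ :=
  if (S ∩ Iio t).Nonempty then sSup (S ∩ Iio t) else t

/-- `S^κ = S \ (ρ(b), b]` for a bounded time scale `S` with `b = max S`. -/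
def upperKappa (S : Set ℝ) : Set ℝ := S \ Ioc (rho S (sSup S)) (sSup S)

/-- `S_κ = S \ [a, σ(a))` for a bounded time scale `S` with `a = min S`. -/
def lowerKappa (S : Set ℝ) : Set ℝ := S \ Ico (sInf S) (sigma S (sInf S))

/-- `f` is delta differentiable at `t` with delta derivative `c`
(used for `t ∈ S^κ`, where `c` is unique if `S` has more than one point). -/
def HasDeltaDerivAt (S : Set ℝ) (f : ℝ → ℝ) (c t : ℝ) : Prop :=
  ∀ ε > 0, ∃ δ > 0, ∀ s ∈ S, |s - t| < δ →
    |f (sigma S t) - f s - c * (sigma S t - s)| ≤ ε * |sigma S t - s|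

/-- `f` is nabla differentiable at `t` with nabla derivative `c`
(used for `t ∈ S_κ`, where `c` is unique if `S` has more than one point). -/
def HasNablaDerivAt (S : Set ℝ) (f : ℝ → ℝ) (c t : ℝ) : Prop :=
  ∀ ε > 0, ∃ δ > 0, ∀ s ∈ S, |s - t| < δ →
    |f (rho S t) - f s - c * (rho S t - s)| ≤ ε * |rho S t - s|

/-- On a bounded time scale with more than one point the delta derivative is unique on `S^κ`. -/
theorem HasDeltaDerivAt.unique {S : Set ℝ} (hbd : Bornology.IsBounded S)
    (hnt : S.Nontrivial) {f : ℝ → ℝ} {t c c' : ℝ} (ht : t ∈ upperKappa S)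
    (h : HasDeltaDerivAt S f c t) (h' : HasDeltaDerivAt S f c' t) : c = c' := by
  have key : ∀ δ > 0, ∃ s ∈ S, |s - t| < δ ∧ sigma S t ≠ s := by
    intro δ hδ
    by_cases hst : sigma S t = t
    · rw [hst]
      by_cases hne : (S ∩ Ioi t).Nonempty
      · rw [sigma, if_pos hne] at hst
        obtain ⟨s, hs, hlt⟩ := exists_lt_of_csInf_lt hne (show sInf (S ∩ Ioi t) < t + δ by linarith)
        have h2 : t < s := hs.2
        exact ⟨s, hs.1, by rw [abs_lt]; constructor <;> linarith, h2.ne⟩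
      · have hmax : ∀ s ∈ S, s ≤ t := fun s hs => by
          by_contra! hh
          exact hne ⟨s, hs, hh⟩
        have hsup : sSup S = t :=
          le_antisymm (csSup_le ⟨t, ht.1⟩ hmax) (le_csSup hbd.bddAbove ht.1)
        have hrho : t ≤ rho S t := by
          by_contra! hh
          exact ht.2 (by rw [hsup]; exact ⟨hh, le_rfl⟩)
        obtain ⟨u, hu, hut⟩ := hnt.exists_ne t
        have hne' : (S ∩ Iio t).Nonempty := ⟨u, hu, lt_of_le_of_ne (hmax u hu) hut⟩
        rw [rho, if_pos hne'] at hrho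
        obtain ⟨s, hs, hlt⟩ := exists_lt_of_lt_csSup hne' (show t - δ < sSup (S ∩ Iio t) by linarith)
        have h2 : s < t := hs.2
        exact ⟨s, hs.1, by rw [abs_lt]; constructor <;> linarith, h2.ne'⟩
    · exact ⟨t, ht.1, by simpa using hδ, hst⟩
  by_contra hcc
  have hpos : 0 < |c - c'| := abs_pos.2 (sub_ne_zero.2 hcc)
  obtain ⟨δ₁, hδ₁, h1⟩ := h (|c - c'| / 4) (by positivity)
  obtain ⟨δ₂, hδ₂, h2⟩ := h' (|c - c'| / 4) (by positivity)
  obtain ⟨s, hs, hlt, hne⟩ := key (min δ₁ δ₂) (lt_min hδ₁ hδ₂)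
  have e1 := h1 s hs (hlt.trans_le (min_le_left _ _))
  have e2 := h2 s hs (hlt.trans_le (min_le_right _ _))
  have hp : 0 < |sigma S t - s| := abs_pos.2 (sub_ne_zero.2 hne)
  have e3 : |c - c'| * |sigma S t - s| ≤ |c - c'| / 4 * |sigma S t - s| +
      |c - c'| / 4 * |sigma S t - s| := by
    rw [← abs_mul]
    calc _ = |(f (sigma S t) - f s - c' * (sigma S t - s)) -
          (f (sigma S t) - f s - c * (sigma S t - s))| := by ring_nf
      _ ≤ _ := (abs_sub _ _).trans (by linarith)
  nlinarith [mul_pos hpos hp]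

open Classical in
/-- The delta derivative `f^Δ(t)` (with value `0` where it does not exist). -/
def deltaDeriv (S : Set ℝ) (f : ℝ → ℝ) (t : ℝ) : ℝ :=
  if h : ∃ c, HasDeltaDerivAt S f c t then h.choose else 0

open Classical in
/-- The nabla derivative `f^∇(t)` (with value `0` where it does not exist). -/
def nablaDeriv (S : Set ℝ) (f : ℝ → ℝ) (t : ℝ) : ℝ :=
  if h : ∃ c, HasNablaDerivAt S f c t then h.choose else 0

/-- The Lebesgue delta measure of a time scale: the image of Lebesgue measure on
`{s : min S ≤ s < sup S}` under `s ↦ max {u ∈ S : u ≤ s}`. It is the measure that is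
concentrated on `S` and gives `[c, d)` the mass `d - c` for all `c ≤ d` in `S`
(`deltaMeasure_compl`, `deltaMeasure_Ico`). -/
def deltaMeasure (S : Set ℝ) : Measure ℝ :=
  (volume.restrict {s | (∃ u ∈ S, u ≤ s) ∧ ∃ v ∈ S, s < v}).map (fun s => sSup (S ∩ Iic s))

/-- The delta integral `∫_c^d f(t) Δt` for `c ≤ d` in `S`. -/
def deltaIntegral (S : Set ℝ) (f : ℝ → ℝ) (c d : ℝ) : ℝ :=
  ∫ t in Ico c d, f t ∂(deltaMeasure S)

theorem measurableSet_deltaDomain (S : Set ℝ) :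
    MeasurableSet {s : ℝ | (∃ u ∈ S, u ≤ s) ∧ ∃ v ∈ S, s < v} := by
  apply Set.OrdConnected.measurableSet
  constructor
  rintro x ⟨⟨u, hu, hux⟩, -⟩ y ⟨-, v, hv, hyv⟩ z ⟨hxz, hzy⟩
  exact ⟨⟨u, hu, hux.trans hxz⟩, v, hv, hzy.trans_lt hyv⟩

theorem aemeasurable_floor (S : Set ℝ) :
    AEMeasurable (fun s => sSup (S ∩ Iic s))
      (volume.restrict {s : ℝ | (∃ u ∈ S, u ≤ s) ∧ ∃ v ∈ S, s < v}) := by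
  apply aemeasurable_restrict_of_monotoneOn (measurableSet_deltaDomain S)
  rintro x ⟨⟨u, hu, hux⟩, -⟩ y - hxy
  exact csSup_le_csSup ⟨y, fun _ h => h.2⟩ ⟨u, hu, hux⟩
    (inter_subset_inter_right _ (Iic_subset_Iic.2 hxy))

theorem deltaMeasure_compl {S : Set ℝ} (hS : IsClosed S) : deltaMeasure S Sᶜ = 0 := by
  rw [deltaMeasure, Measure.map_apply_of_aemeasurable (aemeasurable_floor S)
    hS.measurableSet.compl, Measure.restrict_apply' (measurableSet_deltaDomain S)]
  convert measure_empty (μ := (volume : Measure ℝ))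
  ext s
  simp only [mem_inter_iff, mem_preimage, mem_compl_iff, mem_ofPred_eq, mem_empty_iff_false,
    iff_false, not_and]
  rintro h ⟨u, hu, hus⟩
  exact absurd ((hS.inter isClosed_Iic).csSup_mem ⟨u, hu, hus⟩ ⟨s, fun _ h => h.2⟩).1 h

theorem deltaMeasure_Ico {S : Set ℝ} (hS : IsClosed S) {c d : ℝ} (hc : c ∈ S) (hd : d ∈ S) :
    deltaMeasure S (Ico c d) = ENNReal.ofReal (d - c) := by
  rw [deltaMeasure, Measure.map_apply_of_aemeasurable (aemeasurable_floor S)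
    measurableSet_Ico, Measure.restrict_apply' (measurableSet_deltaDomain S), ← Real.volume_Ico]
  congr 1
  ext s
  simp only [mem_inter_iff, mem_preimage, mem_ofPred_eq, mem_Ico]
  constructor
  · rintro ⟨⟨h1, h2⟩, ⟨u, hu, hus⟩, -⟩
    have hm := (hS.inter isClosed_Iic).csSup_mem ⟨u, hu, hus⟩ ⟨s, fun _ h => h.2⟩
    refine ⟨h1.trans hm.2, ?_⟩
    by_contra! hds
    exact absurd (le_csSup (⟨s, fun _ h => h.2⟩ : BddAbove (S ∩ Iic s)) ⟨hd, hds⟩)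
      (not_le.2 h2)
  · rintro ⟨h1, h2⟩
    have hm := (hS.inter isClosed_Iic).csSup_mem ⟨c, hc, h1⟩ ⟨s, fun _ h => h.2⟩
    exact ⟨⟨le_csSup ⟨s, fun _ h => h.2⟩ ⟨hc, h1⟩, lt_of_le_of_lt hm.2 h2⟩,
      ⟨c, hc, h1⟩, d, hd, h2⟩

/-! ### The delta isoperimetric problem -/

/-- `∂₂F`, the partial derivative of `F(t, x, v)` with respect to `x`. -/
def partial2 (F : ℝ → ℝ → ℝ → ℝ) (t x v : ℝ) : ℝ := deriv (fun z => F t z v) x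

/-- `∂₃F`, the partial derivative of `F(t, x, v)` with respect to `v`. -/
def partial3 (F : ℝ → ℝ → ℝ → ℝ) (t x v : ℝ) : ℝ := deriv (fun z => F t x z) v

/-- Smoothness of a Lagrangian on `T × ℝ²`, required only to first order in `(x, v)`: `F` is
continuous, and `∂₂F`, `∂₃F` exist and are continuous. -/
structure IsSmoothLagrangian (T : Set ℝ) (F : ℝ → ℝ → ℝ → ℝ) : Prop where
  continuousOn : ContinuousOn (fun p : ℝ × ℝ × ℝ => F p.1 p.2.1 p.2.2) (T ×ˢ univ)
  differentiable2 : ∀ t ∈ T, ∀ v, Differentiable ℝ (fun x => F t x v)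
  differentiable3 : ∀ t ∈ T, ∀ x, Differentiable ℝ (fun v => F t x v)
  continuousOn2 : ContinuousOn (fun p : ℝ × ℝ × ℝ => partial2 F p.1 p.2.1 p.2.2) (T ×ˢ univ)
  continuousOn3 : ContinuousOn (fun p : ℝ × ℝ × ℝ => partial3 F p.1 p.2.1 p.2.2) (T ×ˢ univ)

/-- `F[y](t) = F(t, y^σ(t), y^Δ(t))`. -/
def along (S : Set ℝ) (F : ℝ → ℝ → ℝ → ℝ) (y : ℝ → ℝ) (t : ℝ) : ℝ :=
  F t (y (sigma S t)) (deltaDeriv S y t)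

/-- The functional `y ↦ ∫_a^b F(t, y^σ(t), y^Δ(t)) Δt`. -/
def functional (S : Set ℝ) (a b : ℝ) (F : ℝ → ℝ → ℝ → ℝ) (y : ℝ → ℝ) : ℝ :=
  deltaIntegral S (along S F y) a b

/-- `y^Δ` exists and is continuous on `S^κ`. -/
def IsC1Delta (S : Set ℝ) (y : ℝ → ℝ) : Prop :=
  (∀ t ∈ upperKappa S, ∃ c, HasDeltaDerivAt S y c t) ∧
    ContinuousOn (deltaDeriv S y) (upperKappa S)

/-- `‖f‖_∞ = sup |f(t)|` over `t ∈ S^κ ∩ S_κ`, as an extended nonnegative real. -/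
def supNorm (S : Set ℝ) (f : ℝ → ℝ) : ENNReal :=
  ⨆ t ∈ upperKappa S ∩ lowerKappa S, ENNReal.ofReal |f t|

/-- `‖y‖_{1,∞} = ‖y^σ‖_∞ + ‖y^ρ‖_∞ + ‖y^Δ‖_∞ + ‖y^∇‖_∞`. -/
def c1Norm (S : Set ℝ) (y : ℝ → ℝ) : ENNReal :=
  supNorm S (fun t => y (sigma S t)) + supNorm S (fun t => y (rho S t)) +
    supNorm S (deltaDeriv S y) + supNorm S (nablaDeriv S y)

/-- Admissible functions: those of class `C¹` with `y(a) = ya`, `y(b) = yb` and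
`∫_a^b g(t, y^σ, y^Δ) Δt = l`. -/
structure IsAdmissible (S : Set ℝ) (a b : ℝ) (g : ℝ → ℝ → ℝ → ℝ) (ya yb l : ℝ)
    (y : ℝ → ℝ) : Prop where
  c1 : IsC1Delta S y
  left : y a = ya
  right : y b = yb
  constraint : functional S a b g y = l

/-- `y₀` is a local minimizer of `∫_a^b L(t, y^σ, y^Δ) Δt` among the admissible functions. -/
def IsLocalMinimizer (S : Set ℝ) (a b : ℝ) (L g : ℝ → ℝ → ℝ → ℝ) (ya yb l : ℝ)
    (y₀ : ℝ → ℝ) : Prop :=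
  IsAdmissible S a b g ya yb l y₀ ∧
    ∃ δ : ℝ, 0 < δ ∧ ∀ y : ℝ → ℝ, IsAdmissible S a b g ya yb l y →
      c1Norm S (fun t => y t - y₀ t) < ENNReal.ofReal δ →
        functional S a b L y₀ ≤ functional S a b L y

/-- The integral Euler–Lagrange expression `∂₃g[y](t) - ∫_a^t ∂₂g[y](τ) Δτ`. -/
def eulerLagrangeExpr (S : Set ℝ) (a : ℝ) (g : ℝ → ℝ → ℝ → ℝ) (y : ℝ → ℝ) (t : ℝ) : ℝ :=
  along S (partial3 g) y t - deltaIntegral S (along S (partial2 g) y) a t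

/-- `y` is an extremal of `∫_a^b g(t, y^σ, y^Δ) Δt`: it satisfies the integral Euler–Lagrange
equations, at `ρ(t)` for `t ∈ S_κ` and at `t` for `t ∈ S^κ`. -/
def IsExtremal (S : Set ℝ) (a : ℝ) (g : ℝ → ℝ → ℝ → ℝ) (y : ℝ → ℝ) : Prop :=
  (∃ c, ∀ t ∈ lowerKappa S, eulerLagrangeExpr S a g y (rho S t) = c) ∧
    ∃ c, ∀ t ∈ upperKappa S, eulerLagrangeExpr S a g y t = c

end

end TimeScale

/-! Write `S` for the compact scale. Variations run in directions η(t) = ∫_a^t w Δτ with `w`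
continuous and ∫_a^b w Δτ = 0, so that η is C¹ and vanishes at both ends. A single direction
generally breaks the integral constraint, so a second direction `z` is added to compensate. On the
plane of parameters the constrained minimum becomes a finite-dimensional one, to which the Lagrange
multiplier rule applies.

Integration by parts (`integral_mul_sigma_add_integral_mul`, a Fubini argument) turns the first
variation into ∫ E·w, with E the integral Euler–Lagrange expression. The du Bois-Reymond lemma makes
E constant almost everywhere, and `eq_of_ae_eq` upgrades this to all of `S^κ`. The argument is used
twice. For `g`, normality forces some `z` with nonzero first variation. For F = L - λg, where λ is
the quotient of the first variations of `L` and `g` along `z`, the multiplier rule makes the first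
variation vanish for every `w`, so ∂₃F = c + ∫_a^t ∂₂F. Delta differentiation of this identity,
restricted to `S^κ`, gives the conclusion. -/

namespace TimeScale

open Filter Topology

/-! ### Jump operators and the sets `S^κ`, `S_κ` of a compact scale. -/

/-- A compact time scale `S` with minimum `a` and maximum `b > a`. -/
structure IsCompactScale (S : Set ℝ) (a b : ℝ) : Prop where
  isClosed : IsClosed S
  left_mem : a ∈ S
  right_mem : b ∈ S
  subset : S ⊆ Icc a b
  lt : a < b

theorem sigma_of_nonempty {S : Set ℝ} {t : ℝ} (h : (S ∩ Ioi t).Nonempty) :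
    sigma S t = sInf (S ∩ Ioi t) := by rw [sigma, if_pos h]

theorem bddBelow_inter_Ioi (S : Set ℝ) (t : ℝ) : BddBelow (S ∩ Ioi t) :=
  ⟨t, fun _ h => le_of_lt h.2⟩

theorem bddAbove_inter_Iio (S : Set ℝ) (t : ℝ) : BddAbove (S ∩ Iio t) :=
  ⟨t, fun _ h => le_of_lt h.2⟩

theorem le_sigma (S : Set ℝ) (t : ℝ) : t ≤ sigma S t := by
  by_cases h : (S ∩ Ioi t).Nonempty
  · rw [sigma_of_nonempty h]
    exact le_csInf h fun s hs => le_of_lt hs.2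
  · rw [sigma, if_neg h]

theorem sigma_le {S : Set ℝ} {s t : ℝ} (hs : s ∈ S) (hts : t < s) : sigma S t ≤ s := by
  rw [sigma_of_nonempty ⟨s, hs, hts⟩]
  exact csInf_le (bddBelow_inter_Ioi S t) ⟨hs, hts⟩

theorem exists_lt_of_sigma_lt {S : Set ℝ} {t x r : ℝ} (hr : r ∈ S) (htr : t < r)
    (h : sigma S t < x) : ∃ s ∈ S, t < s ∧ s < x := by
  rw [sigma_of_nonempty ⟨r, hr, htr⟩] at h
  obtain ⟨s, hs, hlt⟩ := exists_lt_of_csInf_lt (s := S ∩ Ioi t) ⟨r, hr, htr⟩ h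
  exact ⟨s, hs.1, hs.2, hlt⟩

/-- Monotone maps are Borel; this is the source of measurability for `y ∘ σ`. -/
theorem sigma_mono (S : Set ℝ) : Monotone (sigma S) := by
  intro s t hst
  rcases hst.eq_or_lt with rfl | hlt
  · exact le_rfl
  by_cases h : (S ∩ Ioi t).Nonempty
  · rw [sigma_of_nonempty h]
    exact le_csInf h fun r hr => sigma_le hr.1 (hlt.trans hr.2)
  · rw [sigma.eq_def S t, if_neg h]
    by_cases h' : (S ∩ Ioi s).Nonempty
    · obtain ⟨r, hr, hsr⟩ := h'
      exact (sigma_le hr hsr).trans (not_lt.1 fun hh => h ⟨r, hr, hh⟩)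
    · rw [sigma, if_neg h']
      exact hst

theorem le_rho {S : Set ℝ} {b t : ℝ} (ht : t ∈ S) (htb : t < b) : t ≤ rho S b := by
  rw [rho, if_pos ⟨t, ht, htb⟩]
  exact le_csSup (bddAbove_inter_Iio S b) ⟨ht, htb⟩

namespace IsCompactScale

variable {S : Set ℝ} {a b : ℝ} (h : IsCompactScale S a b)
include h

theorem isCompact : IsCompact S := isCompact_Icc.of_isClosed_subset h.isClosed h.subset

theorem sSup_eq : sSup S = b := IsGreatest.csSup_eq ⟨h.right_mem, fun _ hs => (h.subset hs).2⟩

theorem sInf_eq : sInf S = a := IsLeast.csInf_eq ⟨h.left_mem, fun _ hs => (h.subset hs).1⟩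

theorem nontrivial : S.Nontrivial := ⟨a, h.left_mem, b, h.right_mem, h.lt.ne⟩

theorem sigma_mem {t : ℝ} (ht : t ∈ S) : sigma S t ∈ S := by
  by_cases hn : (S ∩ Ioi t).Nonempty
  · rw [sigma_of_nonempty hn]
    have := closure_mono inter_subset_left (csInf_mem_closure hn (bddBelow_inter_Ioi S t))
    rwa [h.isClosed.closure_eq] at this
  · rwa [sigma, if_neg hn]

theorem upperKappa_eq : upperKappa S = S ∩ Iic (rho S b) := by
  ext t
  rw [upperKappa, h.sSup_eq]
  simp only [Set.mem_sdiff, mem_Ioc, mem_inter_iff, mem_Iic, not_and, not_le]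
  refine and_congr_right fun ht => ⟨fun h1 => ?_, fun h1 h2 => absurd h1 (not_le.2 h2)⟩
  by_contra! h2
  exact absurd (h1 h2) (not_lt.2 (h.subset ht).2)

theorem isCompact_upperKappa : IsCompact (upperKappa S) := by
  rw [h.upperKappa_eq]
  exact h.isCompact.inter_right isClosed_Iic

theorem mem_upperKappa {t : ℝ} (ht : t ∈ S) (htb : t < b) : t ∈ upperKappa S := by
  rw [h.upperKappa_eq]
  exact ⟨ht, le_rho ht htb⟩

theorem sigma_right : sigma S b = b := by
  rw [sigma, if_neg]
  rintro ⟨s, hs, hlt⟩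
  exact absurd (h.subset hs).2 (not_le.2 hlt)

theorem lt_right_of_lt_sigma {t : ℝ} (ht : t ∈ S) (hlt : t < sigma S t) : t < b := by
  refine lt_of_le_of_ne (h.subset ht).2 ?_
  rintro rfl
  exact hlt.ne h.sigma_right.symm

/-- If `b` belongs to `S^κ`, then `b` is a limit of points of `S` from the left. -/
theorem exists_mem_Ioo_of_right_mem (hb : b ∈ upperKappa S) {x : ℝ} (hx : x < b) :
    ∃ s ∈ S, x < s ∧ s < b := by
  rw [h.upperKappa_eq] at hb
  have h2 : b ≤ rho S b := hb.2
  rw [rho, if_pos ⟨a, h.left_mem, h.lt⟩] at h2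
  obtain ⟨s, hs, hlt⟩ := exists_lt_of_lt_csSup (s := S ∩ Iio b) ⟨a, h.left_mem, h.lt⟩ (hx.trans_le h2)
  exact ⟨s, hs.1, hlt, hs.2⟩

theorem rho_mem_upperKappa {t : ℝ} (ht : t ∈ lowerKappa S) : rho S t ∈ upperKappa S := by
  obtain ⟨htS, hta⟩ := ht
  rw [h.sInf_eq] at hta
  by_cases hn : (S ∩ Iio t).Nonempty
  · rw [h.upperKappa_eq, rho.eq_def S t, if_pos hn]
    have := closure_mono inter_subset_left (csSup_mem_closure hn (bddAbove_inter_Iio S t))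
    rw [h.isClosed.closure_eq] at this
    refine ⟨this, ?_⟩
    exact csSup_le hn fun s hs => le_rho hs.1 (lt_of_lt_of_le hs.2 (h.subset htS).2)
  · rw [rho, if_neg hn]
    apply h.mem_upperKappa htS
    have : t ≤ a := not_lt.1 fun hh => hn ⟨a, h.left_mem, hh⟩
    exact this.trans_lt h.lt

/-- Points of `S` other than `ρ(t)` accumulate at each `t ∈ S_κ`. -/
theorem exists_ne_rho {t : ℝ} (ht : t ∈ lowerKappa S) {δ : ℝ} (hδ : 0 < δ) :
    ∃ s ∈ S, |s - t| < δ ∧ rho S t ≠ s := by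
  obtain ⟨htS, hta⟩ := ht
  rw [h.sInf_eq] at hta
  by_cases hr : rho S t = t
  · rw [hr]
    by_cases hn : (S ∩ Iio t).Nonempty
    · rw [rho, if_pos hn] at hr
      obtain ⟨s, hs, hlt⟩ := exists_lt_of_lt_csSup hn (show t - δ < sSup (S ∩ Iio t) by linarith)
      have h2 : s < t := hs.2
      exact ⟨s, hs.1, by rw [abs_lt]; constructor <;> linarith, h2.ne'⟩
    · have hat : t = a :=
        le_antisymm (not_lt.1 fun hh => hn ⟨a, h.left_mem, hh⟩) (h.subset htS).1
      subst hat
      have hs : sigma S t ≤ t := not_lt.1 fun hh => hta ⟨le_rfl, hh⟩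
      obtain ⟨s, hs, h1, h2⟩ := exists_lt_of_sigma_lt h.right_mem h.lt
        (show sigma S t < t + δ by linarith)
      exact ⟨s, hs, by rw [abs_lt]; constructor <;> linarith, h1.ne⟩
  · exact ⟨t, htS, by simpa using hδ, hr⟩

/-- For `s` below a scale point `r` slightly to the right of `t`, one has s ≤ σ(s) ≤ r; at t = b the
bound σ(s) ≤ b serves instead. At left-dense, right-scattered points `σ` jumps, so continuity is
claimed only where σ(t) = t. -/
theorem sigma_continuousWithinAt {t : ℝ} (ht : t ∈ S) (hst : sigma S t = t) :
    ContinuousWithinAt (sigma S) S t := by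
  rw [Metric.continuousWithinAt_iff]
  intro ε hε
  rw [hst]
  simp only [Real.dist_eq, abs_lt]
  rcases (h.subset ht).2.eq_or_lt with rfl | htb
  · refine ⟨ε, hε, fun {s} hs h1 => ⟨?_, ?_⟩⟩
    · linarith [le_sigma S s]
    · have := (h.subset (h.sigma_mem hs)).2
      linarith
  · obtain ⟨r, hr, h1, h2⟩ := exists_lt_of_sigma_lt h.right_mem htb
        (show sigma S t < t + ε by linarith)
    refine ⟨r - t, by linarith, fun {s} hs h3 => ⟨?_, ?_⟩⟩
    · linarith [le_sigma S s]
    · linarith [sigma_le hr (show s < r by linarith)]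

/-- `S^κ` is an initial segment of `S`, so the jump can change only when its target has been
removed; this is what the condition σ(t) ∈ S^κ prevents. -/
theorem sigma_upperKappa {t : ℝ} (hs : sigma S t ∈ upperKappa S) : sigma (upperKappa S) t = sigma S t := by
  rcases (le_sigma S t).eq_or_lt with he | hlt
  · rw [← he]
    refine le_antisymm ?_ (le_sigma _ _)
    by_contra! hlt
    have hne : (upperKappa S ∩ Ioi t).Nonempty := by
      by_contra hn
      rw [sigma, if_neg hn] at hlt
      exact hlt.ne rfl
    obtain ⟨r, hr, htr⟩ := hne
    obtain ⟨s, hsS, h1, h2⟩ := exists_lt_of_sigma_lt (x := sigma (upperKappa S) t)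
      hr.1 htr (by rwa [← he])
    have hsk : s ∈ upperKappa S := by
      rw [h.upperKappa_eq] at hr ⊢
      exact ⟨hsS, (h2.le.trans (sigma_le (by rwa [h.upperKappa_eq]) htr)).trans hr.2⟩
    exact absurd (sigma_le hsk h1) (not_le.2 h2)
  · refine le_antisymm (sigma_le hs hlt) ?_
    rw [sigma_of_nonempty ⟨_, hs, hlt⟩]
    exact le_csInf ⟨_, hs, hlt⟩ fun s hs => sigma_le hs.1.1 hs.2

end IsCompactScale

/-! ### Calculus of the delta derivative. -/

theorem HasDeltaDerivAt.add {S : Set ℝ} {f g : ℝ → ℝ} {c d t : ℝ}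
    (hf : HasDeltaDerivAt S f c t) (hg : HasDeltaDerivAt S g d t) :
    HasDeltaDerivAt S (fun s => f s + g s) (c + d) t := by
  intro ε hε
  obtain ⟨δ₁, h1, hf⟩ := hf (ε / 2) (half_pos hε)
  obtain ⟨δ₂, h2, hg⟩ := hg (ε / 2) (half_pos hε)
  refine ⟨min δ₁ δ₂, lt_min h1 h2, fun s hs hlt => ?_⟩
  have e1 := hf s hs (hlt.trans_le (min_le_left _ _))
  have e2 := hg s hs (hlt.trans_le (min_le_right _ _))
  calc _ = |(f (sigma S t) - f s - c * (sigma S t - s)) +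
        (g (sigma S t) - g s - d * (sigma S t - s))| := by ring_nf
    _ ≤ _ := (abs_add_le _ _).trans (by linarith)

theorem HasDeltaDerivAt.const_mul {S : Set ℝ} {f : ℝ → ℝ} {c t : ℝ} (k : ℝ)
    (hf : HasDeltaDerivAt S f c t) : HasDeltaDerivAt S (fun s => k * f s) (k * c) t := by
  intro ε hε
  have hk : 0 < |k| + 1 := by positivity
  obtain ⟨δ, h1, hf⟩ := hf (ε / (|k| + 1)) (by positivity)
  refine ⟨δ, h1, fun s hs hlt => ?_⟩
  have e1 := hf s hs hlt
  calc _ = |k * (f (sigma S t) - f s - c * (sigma S t - s))| := by ring_nf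
    _ = |k| * |f (sigma S t) - f s - c * (sigma S t - s)| := abs_mul _ _
    _ ≤ (|k| + 1) * (ε / (|k| + 1) * |sigma S t - s|) := by gcongr; linarith
    _ = _ := by field_simp

/-- Delta differentiability passes to a smaller time scale with the same `σ(t)`, and to a function
that differs from the given one by a constant. -/
theorem HasDeltaDerivAt.congr_of_subset {S R : Set ℝ} {f g : ℝ → ℝ} {c t k : ℝ}
    (hf : HasDeltaDerivAt S f c t) (hRS : R ⊆ S) (hs : sigma R t = sigma S t)
    (hsR : sigma S t ∈ R) (hfg : ∀ s ∈ R, g s = k + f s) : HasDeltaDerivAt R g c t := by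
  intro ε hε
  obtain ⟨δ, hδ, h⟩ := hf ε hε
  refine ⟨δ, hδ, fun s hsm hlt => ?_⟩
  rw [hs, hfg s hsm, hfg _ hsR, add_sub_add_left_eq_sub]
  exact h s (hRS hsm) hlt

theorem HasDeltaDerivAt.continuousWithinAt {S : Set ℝ} {f : ℝ → ℝ} {c t : ℝ} (ht : t ∈ S)
    (hf : HasDeltaDerivAt S f c t) : ContinuousWithinAt f S t := by
  -- Taking s = t in the definition, for every ε, gives the exact increment across the gap.
  have hσ : f (sigma S t) - f t = c * (sigma S t - t) := by
    have key : |f (sigma S t) - f t - c * (sigma S t - t)| ≤ 0 := by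
      refine le_of_forall_pos_le_add fun ε hε => ?_
      have hp : 0 < |sigma S t - t| + 1 := by positivity
      obtain ⟨δ, hδ, h⟩ := hf (ε / (|sigma S t - t| + 1)) (by positivity)
      refine (h t ht (by simpa using hδ)).trans ?_
      rw [zero_add, div_mul_eq_mul_div, div_le_iff₀ hp]
      nlinarith
    linarith [abs_nonpos_iff.1 key]
  rw [Metric.continuousWithinAt_iff]
  intro ε hε
  have hp : 0 < |sigma S t - t| + 1 := by positivity
  have hc : 0 < |c| + 1 := by positivity
  obtain ⟨δ, hδ, h⟩ := hf (ε / 2 / (|sigma S t - t| + 1)) (by positivity)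
  refine ⟨min (min δ 1) (ε / 2 / (|c| + 1)), by positivity, fun {s} hs hlt => ?_⟩
  rw [Real.dist_eq] at hlt ⊢
  have l1 := hlt.trans_le ((min_le_left _ _).trans (min_le_left _ _))
  have l2 := hlt.trans_le ((min_le_left _ _).trans (min_le_right _ _))
  have l3 := hlt.trans_le (min_le_right _ _)
  have e1 := h s hs l1
  have e2 : |sigma S t - s| ≤ |sigma S t - t| + 1 := by
    have := abs_sub_le (sigma S t) t s
    rw [abs_sub_comm t s] at this
    linarith
  have e3 : ε / 2 / (|sigma S t - t| + 1) * |sigma S t - s| ≤ ε / 2 := by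
    calc _ ≤ ε / 2 / (|sigma S t - t| + 1) * (|sigma S t - t| + 1) := by gcongr
      _ = _ := by field_simp
  have e4 : |c * (s - t)| < ε / 2 := by
    rw [abs_mul]
    rw [lt_div_iff₀ hc] at l3
    nlinarith [abs_nonneg (s - t), abs_nonneg c]
  have e5 : f s - f t = -(f (sigma S t) - f s - c * (sigma S t - s)) + c * (s - t) := by
    linear_combination hσ
  rw [e5]
  refine (abs_add_le _ _).trans_lt ?_
  rw [abs_neg]
  linarith

theorem IsCompactScale.deltaDeriv_eq {S : Set ℝ} {a b : ℝ} (h : IsCompactScale S a b)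
    {f : ℝ → ℝ} {t c : ℝ} (ht : t ∈ upperKappa S) (hf : HasDeltaDerivAt S f c t) :
    deltaDeriv S f t = c := by
  have hex : ∃ c, HasDeltaDerivAt S f c t := ⟨c, hf⟩
  rw [deltaDeriv, dif_pos hex]
  exact HasDeltaDerivAt.unique h.isCompact.isBounded h.nontrivial ht hex.choose_spec hf

/-- Delta differentiability gives continuity on `S^κ`; the only point that can be missing is `b`,
which is then isolated. -/
theorem IsCompactScale.continuousOn_of_isC1Delta {S : Set ℝ} {a b : ℝ} (h : IsCompactScale S a b)
    {f : ℝ → ℝ} (hf : IsC1Delta S f) : ContinuousOn f S := by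
  intro t ht
  by_cases hk : t ∈ upperKappa S
  · obtain ⟨c, hc⟩ := hf.1 t hk
    exact hc.continuousWithinAt ht
  · rw [h.upperKappa_eq] at hk
    have hlt : rho S b < t := not_le.1 fun hh => hk ⟨ht, hh⟩
    have htb : t = b := by
      by_contra hne
      exact hk ⟨ht, le_rho ht (lt_of_le_of_ne (h.subset ht).2 hne)⟩
    subst htb
    rw [Metric.continuousWithinAt_iff]
    refine fun ε hε => ⟨t - rho S t, sub_pos.2 hlt, fun {s} hs hst => ?_⟩
    have hs' : s = t := by
      by_contra hne
      have := le_rho hs (lt_of_le_of_ne (h.subset hs).2 hne)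
      rw [Real.dist_eq, abs_lt] at hst
      linarith [hst.1]
    rwa [hs', dist_self]

/-! ### Bounds for the C¹ norm. -/

/-- The nabla derivative of a `K`-Lipschitz function is bounded by `K` on `S_κ`. -/
theorem IsCompactScale.abs_nablaDeriv_le {S : Set ℝ} {a b : ℝ} (h : IsCompactScale S a b)
    {f : ℝ → ℝ} {K t : ℝ} (hK : 0 ≤ K) (ht : t ∈ lowerKappa S)
    (hf : ∀ s ∈ S, ∀ r ∈ S, |f s - f r| ≤ K * |s - r|) : |nablaDeriv S f t| ≤ K := by
  rw [nablaDeriv]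
  split_ifs with hex
  · have hc := hex.choose_spec
    set c := hex.choose
    refine le_of_forall_pos_le_add fun ε hε => ?_
    obtain ⟨δ, hδ, h1⟩ := hc ε hε
    obtain ⟨s, hs, hlt, hne⟩ := h.exists_ne_rho ht hδ
    have e1 := h1 s hs hlt
    have e2 := hf _ (h.rho_mem_upperKappa ht).1 s hs
    have hp : 0 < |rho S t - s| := abs_pos.2 (sub_ne_zero.2 hne)
    have e3 : |c * (rho S t - s)| ≤ (K + ε) * |rho S t - s| := by
      calc _ = |(f (rho S t) - f s) - (f (rho S t) - f s - c * (rho S t - s))| := by ring_nf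
        _ ≤ _ := (abs_sub _ _).trans (by linarith)
    rw [abs_mul] at e3
    exact le_of_mul_le_mul_right e3 hp
  -- Where no nabla derivative exists, `nablaDeriv` is 0.
  · simpa using hK

theorem supNorm_le {S : Set ℝ} {f : ℝ → ℝ} {C : ℝ}
    (hf : ∀ t ∈ upperKappa S ∩ lowerKappa S, |f t| ≤ C) : supNorm S f ≤ ENNReal.ofReal C :=
  iSup₂_le fun t ht => ENNReal.ofReal_le_ofReal (hf t ht)

/-- A function with values and difference quotients bounded by `K` has `c1Norm` at most `4 K`. -/
theorem IsCompactScale.c1Norm_le {S : Set ℝ} {a b : ℝ} (h : IsCompactScale S a b)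
    {f : ℝ → ℝ} {K : ℝ} (hK : 0 ≤ K) (hb : ∀ s ∈ S, |f s| ≤ K)
    (hf : ∀ s ∈ S, ∀ r ∈ S, |f s - f r| ≤ K * |s - r|)
    (hd : ∀ t ∈ upperKappa S, |deltaDeriv S f t| ≤ K) :
    c1Norm S f ≤ ENNReal.ofReal (4 * K) := by
  have e : ENNReal.ofReal (4 * K) = ENNReal.ofReal K + ENNReal.ofReal K + ENNReal.ofReal K +
      ENNReal.ofReal K := by
    rw [← ENNReal.ofReal_add hK hK, ← ENNReal.ofReal_add (by positivity) hK,
      ← ENNReal.ofReal_add (by positivity) hK]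
    ring_nf
  rw [e, c1Norm]
  gcongr
  · exact supNorm_le fun t ht => hb _ (h.sigma_mem ht.1.1)
  · exact supNorm_le fun t ht => hb _ (h.rho_mem_upperKappa ht.2).1
  · exact supNorm_le fun t ht => hd t ht.1
  · exact supNorm_le fun t ht => h.abs_nablaDeriv_le hK ht.2 hf

/-! ### The delta integral as a function of its upper limit. -/

namespace IsCompactScale

variable {S : Set ℝ} {a b : ℝ} (h : IsCompactScale S a b)
include h

theorem isFiniteMeasure : IsFiniteMeasure ((deltaMeasure S).restrict (Ico a b)) := by
  refine ⟨?_⟩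
  rw [Measure.restrict_apply_univ, deltaMeasure_Ico h.isClosed h.left_mem h.right_mem]
  exact ENNReal.ofReal_lt_top

theorem ae_mem : ∀ᵐ t ∂(deltaMeasure S).restrict (Ico a b), t ∈ S ∧ t ∈ Ico a b := by
  have h1 : ∀ᵐ t ∂(deltaMeasure S).restrict (Ico a b), t ∈ S :=
    ae_restrict_of_ae (deltaMeasure_compl h.isClosed)
  filter_upwards [h1, ae_restrict_mem measurableSet_Ico] with t h1 h2 using ⟨h1, h2⟩

theorem deltaIntegral_sub {f : ℝ → ℝ} (hf : IntegrableOn f (Ico a b) (deltaMeasure S)) {c d : ℝ}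
    (hc : c ∈ S) (hd : d ∈ S) (hcd : c ≤ d) :
    deltaIntegral S f a d - deltaIntegral S f a c = deltaIntegral S f c d := by
  have hac := (h.subset hc).1
  have hdb := (h.subset hd).2
  rw [sub_eq_iff_eq_add', deltaIntegral, deltaIntegral, deltaIntegral,
    ← Ico_union_Ico_eq_Ico hac hcd]
  refine setIntegral_union ?_ measurableSet_Ico (hf.mono_set ?_) (hf.mono_set ?_)
  · rw [Set.disjoint_left]
    exact fun x hx hx' => absurd hx.2 (not_lt.2 hx'.1)
  · exact Ico_subset_Ico le_rfl (hcd.trans hdb)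
  · exact Ico_subset_Ico hac hdb

/-- The basic estimate, since [c, d) has mass d - c. With k = 0 it gives Lipschitz bounds, with k =
f(t) and small C the derivative at right-dense points, and with C = 0 the integral across one gap.
-/
theorem abs_deltaIntegral_sub_le {f : ℝ → ℝ} (hf : IntegrableOn f (Ico a b) (deltaMeasure S))
    {c d k C : ℝ} (hc : c ∈ S) (hd : d ∈ S) (hcd : c ≤ d)
    (hC : ∀ t ∈ S, c ≤ t → t < d → |f t - k| ≤ C) :
    |deltaIntegral S f c d - k * (d - c)| ≤ C * (d - c) := by
  have hm := deltaMeasure_Ico h.isClosed hc hd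
  have hfin : deltaMeasure S (Ico c d) < ⊤ := by rw [hm]; exact ENNReal.ofReal_lt_top
  have hreal : (deltaMeasure S).real (Ico c d) = d - c := by
    rw [Measure.real, hm, ENNReal.toReal_ofReal (sub_nonneg.2 hcd)]
  have hf' : IntegrableOn f (Ico c d) (deltaMeasure S) :=
    hf.mono_set (Ico_subset_Ico (h.subset hc).1 (h.subset hd).2)
  have e : deltaIntegral S f c d - k * (d - c) =
      ∫ t in Ico c d, (f t - k) ∂(deltaMeasure S) := by
    rw [integral_sub hf' (integrableOn_const hfin.ne), setIntegral_const, hreal, smul_eq_mul,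
      deltaIntegral]
    ring
  rw [e, ← Real.norm_eq_abs, ← hreal]
  refine norm_setIntegral_le_of_norm_le_const_ae' hfin ?_
  have h1 : ∀ᵐ t ∂(deltaMeasure S), t ∈ S := deltaMeasure_compl h.isClosed
  filter_upwards [h1] with t ht htm using hC t ht htm.1 htm.2

/-- The interval [t, σ(t)) meets `S` in at most the point `t`. -/
theorem deltaIntegral_sigma {f : ℝ → ℝ} (hf : IntegrableOn f (Ico a b) (deltaMeasure S)) {t : ℝ}
    (ht : t ∈ S) : deltaIntegral S f t (sigma S t) = f t * (sigma S t - t) := by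
  have := h.abs_deltaIntegral_sub_le (k := f t) (C := 0) hf ht (h.sigma_mem ht) (le_sigma S t)
    (fun s hs h1 h2 => ?_)
  · rw [zero_mul] at this
    linarith [abs_nonpos_iff.1 this]
  · have : s = t := by
      by_contra hne
      exact absurd (sigma_le hs (lt_of_le_of_ne h1 (Ne.symm hne))) (not_le.2 h2)
    simp [this]

/-- The integral `∫_a^t f Δτ` is delta differentiable with derivative `f(t)`, if `f` is bounded,
and continuous at `t` in case `t` is right-dense. -/
theorem hasDeltaDerivAt_deltaIntegral {f : ℝ → ℝ}
    (hf : IntegrableOn f (Ico a b) (deltaMeasure S)) {C : ℝ}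
    (hC : ∀ t ∈ upperKappa S, |f t| ≤ C) {t : ℝ} (ht : t ∈ S)
    (hcont : sigma S t = t → ContinuousWithinAt f (upperKappa S) t) :
    HasDeltaDerivAt S (fun s => deltaIntegral S f a s) (f t) t := by
  intro ε hε
  rcases (le_sigma S t).eq_or_lt with he | hlt
  · obtain ⟨δ, hδ, hc⟩ := Metric.continuousWithinAt_iff.1 (hcont he.symm) ε hε
    refine ⟨δ, hδ, fun s hs hst => ?_⟩
    simp only [← he]
    rcases le_total s t with hle | hle
    · rw [h.deltaIntegral_sub hf hs ht hle, abs_of_nonneg (sub_nonneg.2 hle)]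
      refine h.abs_deltaIntegral_sub_le hf hs ht hle fun r hr h1 h2 => ?_
      refine (hc (h.mem_upperKappa hr (h2.trans_le (h.subset ht).2)) ?_).le
      rw [Real.dist_eq, abs_lt] at *
      constructor <;> linarith
    · have e := h.deltaIntegral_sub hf ht hs hle
      rw [show deltaIntegral S f a t - deltaIntegral S f a s - f t * (t - s) =
        -(deltaIntegral S f t s - f t * (s - t)) by rw [← e]; ring, abs_neg, abs_sub_comm t s,
        abs_of_nonneg (sub_nonneg.2 hle)]
      refine h.abs_deltaIntegral_sub_le hf ht hs hle fun r hr h1 h2 => ?_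
      refine (hc (h.mem_upperKappa hr (h2.trans_le (h.subset hs).2)) ?_).le
      rw [Real.dist_eq, abs_lt] at *
      constructor <;> linarith
  · have htb := h.lt_right_of_lt_sigma ht hlt
    have htC := hC t (h.mem_upperKappa ht htb)
    have hC0 : 0 ≤ C := (abs_nonneg _).trans htC
    have hd : 0 < sigma S t - t := sub_pos.2 hlt
    have hden : 0 < 2 * C + 1 := by positivity
    -- At a right-scattered `t` no continuity is available. The first bound excludes s > t. The
    -- second makes the error 2C(t - s) at most ε(σ(t) - t), hence at most ε(σ(t) - s).
    refine ⟨min (sigma S t - t) (ε * (sigma S t - t) / (2 * C + 1)), by positivity,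
      fun s hs hst => ?_⟩
    have h1 := hst.trans_le (min_le_left _ _)
    have h2 := hst.trans_le (min_le_right _ _)
    have hle : s ≤ t := by
      by_contra! hh
      rw [abs_lt] at h1
      linarith [sigma_le hs hh]
    have e1 := h.deltaIntegral_sub hf ht (h.sigma_mem ht) hlt.le
    have e2 := h.deltaIntegral_sub hf hs ht hle
    rw [h.deltaIntegral_sigma hf ht] at e1
    have e3 := h.abs_deltaIntegral_sub_le (k := f t) (C := 2 * C) hf hs ht hle
      fun r hr _ h2 => (abs_sub _ _).trans
        (by linarith [hC r (h.mem_upperKappa hr (h2.trans htb))])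
    rw [show deltaIntegral S f a (sigma S t) - deltaIntegral S f a s - f t * (sigma S t - s) =
      deltaIntegral S f s t - f t * (t - s) by rw [← e2]; linear_combination e1,
      abs_of_nonneg (show 0 ≤ sigma S t - s by linarith)]
    refine e3.trans ?_
    rw [lt_div_iff₀ hden, abs_sub_comm, abs_of_nonneg (sub_nonneg.2 hle)] at h2
    nlinarith

end IsCompactScale

/-! ### Lagrangians along functions -/

/-- Composition of a function continuous on `S × ℝ²` with measurable functions. -/
theorem aestronglyMeasurable_comp {S : Set ℝ} (hS : IsClosed S) {F : ℝ → ℝ → ℝ → ℝ}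
    (hF : ContinuousOn (fun p : ℝ × ℝ × ℝ => F p.1 p.2.1 p.2.2) (S ×ˢ univ)) {μ : Measure ℝ}
    (hμ : ∀ᵐ t ∂μ, t ∈ S) {u v : ℝ → ℝ} (hu : AEMeasurable u μ) (hv : AEMeasurable v μ) :
    AEStronglyMeasurable (fun t => F t (u t) (v t)) μ := by
  classical
  -- `F` is controlled only over `S`; extension by zero off a closed set is Borel.
  have hm : Measurable ((S ×ˢ univ).piecewise (fun p : ℝ × ℝ × ℝ => F p.1 p.2.1 p.2.2)
      (fun _ => 0)) :=
    hF.measurable_piecewise continuousOn_const (hS.prod isClosed_univ).measurableSet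
  refine AEMeasurable.aestronglyMeasurable
    ((hm.comp_aemeasurable (aemeasurable_id.prodMk (hu.prodMk hv))).congr ?_)
  filter_upwards [hμ] with t ht
  simp [ht]

theorem exists_bound_of_continuousOn {S K : Set ℝ} (hK : IsCompact K) (hKS : K ⊆ S)
    {F : ℝ → ℝ → ℝ → ℝ}
    (hF : ContinuousOn (fun p : ℝ × ℝ × ℝ => F p.1 p.2.1 p.2.2) (S ×ˢ univ)) (M : ℝ) :
    ∃ C, ∀ t ∈ K, ∀ x v, |x| ≤ M → |v| ≤ M → |F t x v| ≤ C := by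
  obtain ⟨C, hC⟩ := (hK.prod ((isCompact_Icc (a := -M) (b := M)).prod
    (isCompact_Icc (a := -M) (b := M)))).exists_bound_of_continuousOn
    (hF.mono (prod_mono hKS (subset_univ _)))
  exact ⟨C, fun t ht x v hx hv => hC (t, x, v) ⟨ht, abs_le.1 hx, abs_le.1 hv⟩⟩

namespace IsCompactScale

variable {S : Set ℝ} {a b : ℝ} (h : IsCompactScale S a b)
include h

theorem aemeasurable_comp_sigma {y : ℝ → ℝ} (hy : ContinuousOn y S) :
    AEMeasurable (fun t => y (sigma S t)) ((deltaMeasure S).restrict (Ico a b)) := by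
  classical
  have hm : Measurable (S.piecewise y fun _ => 0) :=
    hy.measurable_piecewise continuousOn_const h.isClosed.measurableSet
  refine (hm.comp (sigma_mono S).measurable).aemeasurable.congr ?_
  filter_upwards [h.ae_mem] with t ht
  simp [h.sigma_mem ht.1]

theorem aemeasurable_of_continuousOn {w : ℝ → ℝ} (hw : ContinuousOn w (upperKappa S)) :
    AEMeasurable w ((deltaMeasure S).restrict (Ico a b)) := by
  classical
  have hm : Measurable ((upperKappa S).piecewise w fun _ => 0) :=
    hw.measurable_piecewise continuousOn_const h.isCompact_upperKappa.isClosed.measurableSet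
  refine hm.aemeasurable.congr ?_
  filter_upwards [h.ae_mem] with t ht
  simp [h.mem_upperKappa ht.1 ht.2.2]

theorem exists_bound_isC1Delta {y : ℝ → ℝ} (hy : IsC1Delta S y) :
    ∃ M, (∀ t ∈ S, |y (sigma S t)| ≤ M) ∧ ∀ t ∈ upperKappa S, |deltaDeriv S y t| ≤ M := by
  obtain ⟨M₁, h1⟩ := h.isCompact.exists_bound_of_continuousOn (h.continuousOn_of_isC1Delta hy)
  obtain ⟨M₂, h2⟩ := h.isCompact_upperKappa.exists_bound_of_continuousOn hy.2
  exact ⟨max M₁ M₂, fun t ht => (h1 _ (h.sigma_mem ht)).trans (le_max_left _ _),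
    fun t ht => (h2 t ht).trans (le_max_right _ _)⟩

variable {F : ℝ → ℝ → ℝ → ℝ}
  (hF : ContinuousOn (fun p : ℝ × ℝ × ℝ => F p.1 p.2.1 p.2.2) (S ×ˢ univ))
  {y : ℝ → ℝ} (hy : IsC1Delta S y)
include hF hy

theorem exists_bound_along : ∃ C, ∀ t ∈ upperKappa S, |along S F y t| ≤ C := by
  obtain ⟨M, h1, h2⟩ := h.exists_bound_isC1Delta hy
  obtain ⟨C, hC⟩ := exists_bound_of_continuousOn h.isCompact_upperKappa sdiff_subset hF M
  exact ⟨C, fun t ht => hC t ht _ _ (h1 t ht.1) (h2 t ht)⟩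

theorem integrableOn_along : IntegrableOn (along S F y) (Ico a b) (deltaMeasure S) := by
  have := h.isFiniteMeasure
  obtain ⟨C, hC⟩ := h.exists_bound_along hF hy
  refine Integrable.of_bound (aestronglyMeasurable_comp h.isClosed hF
    (h.ae_mem.mono fun _ ht => ht.1)
    (h.aemeasurable_comp_sigma (h.continuousOn_of_isC1Delta hy))
    (h.aemeasurable_of_continuousOn hy.2)) C ?_
  filter_upwards [h.ae_mem] with t ht using hC t (h.mem_upperKappa ht.1 ht.2.2)

/-- `F(t, y^σ(t), y^Δ(t))` is continuous at right-dense points. -/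
theorem continuousWithinAt_along {t : ℝ} (ht : t ∈ upperKappa S) (hst : sigma S t = t) :
    ContinuousWithinAt (along S F y) (upperKappa S) t := by
  have h1 : ContinuousWithinAt (fun s => y (sigma S s)) S t := by
    refine ContinuousWithinAt.comp (t := S) ?_ (h.sigma_continuousWithinAt ht.1 hst)
      fun s hs => h.sigma_mem hs
    rw [hst]
    exact h.continuousOn_of_isC1Delta hy t ht.1
  have h2 : ContinuousWithinAt (fun s => (s, y (sigma S s), deltaDeriv S y s)) (upperKappa S) t :=
    continuousWithinAt_id.prodMk ((h1.mono sdiff_subset).prodMk (hy.2 t ht))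
  exact ContinuousWithinAt.comp (t := S ×ˢ univ) (hF _ ⟨ht.1, mem_univ _⟩) h2
    fun s hs => ⟨hs.1, mem_univ _⟩

end IsCompactScale

theorem IsSmoothLagrangian.mono {S T : Set ℝ} {F : ℝ → ℝ → ℝ → ℝ} (hF : IsSmoothLagrangian T F)
    (hST : S ⊆ T) : IsSmoothLagrangian S F where
  continuousOn := hF.continuousOn.mono (prod_mono hST subset_rfl)
  differentiable2 t ht := hF.differentiable2 t (hST ht)
  differentiable3 t ht := hF.differentiable3 t (hST ht)
  continuousOn2 := hF.continuousOn2.mono (prod_mono hST subset_rfl)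
  continuousOn3 := hF.continuousOn3.mono (prod_mono hST subset_rfl)

section SubMul

variable {S : Set ℝ} {L g : ℝ → ℝ → ℝ → ℝ} (hL : IsSmoothLagrangian S L)
  (hg : IsSmoothLagrangian S g) (k : ℝ)
include hL hg

theorem partial2_sub_mul {t : ℝ} (ht : t ∈ S) (x v : ℝ) :
    partial2 (fun t x v => L t x v - k * g t x v) t x v = partial2 L t x v - k * partial2 g t x v :=
  ((hL.differentiable2 t ht v x).hasDerivAt.sub
    ((hg.differentiable2 t ht v x).hasDerivAt.const_mul k)).deriv

theorem partial3_sub_mul {t : ℝ} (ht : t ∈ S) (x v : ℝ) :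
    partial3 (fun t x v => L t x v - k * g t x v) t x v = partial3 L t x v - k * partial3 g t x v :=
  ((hL.differentiable3 t ht x v).hasDerivAt.sub
    ((hg.differentiable3 t ht x v).hasDerivAt.const_mul k)).deriv

theorem IsSmoothLagrangian.sub_mul :
    IsSmoothLagrangian S (fun t x v => L t x v - k * g t x v) where
  continuousOn := hL.continuousOn.sub (continuousOn_const.mul hg.continuousOn)
  differentiable2 t ht v := (hL.differentiable2 t ht v).sub ((hg.differentiable2 t ht v).const_mul k)
  differentiable3 t ht x := (hL.differentiable3 t ht x).sub ((hg.differentiable3 t ht x).const_mul k)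
  continuousOn2 := (hL.continuousOn2.sub (continuousOn_const.mul hg.continuousOn2)).congr
    fun _ hp => partial2_sub_mul hL hg k hp.1 _ _
  continuousOn3 := (hL.continuousOn3.sub (continuousOn_const.mul hg.continuousOn3)).congr
    fun _ hp => partial3_sub_mul hL hg k hp.1 _ _

end SubMul

section Slice

variable {S : Set ℝ} {F : ℝ → ℝ → ℝ → ℝ}

theorem continuous_slice
    (hF : ContinuousOn (fun p : ℝ × ℝ × ℝ => F p.1 p.2.1 p.2.2) (S ×ˢ univ)) {t : ℝ}
    (ht : t ∈ S) : Continuous fun q : ℝ × ℝ => F t q.1 q.2 :=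
  hF.comp_continuous (f := fun q : ℝ × ℝ => (t, q)) (by fun_prop) fun _ => ⟨ht, mem_univ _⟩

/-- Continuity of both partial derivatives in (x, v) upgrades separate to joint differentiability,
as the chain rule requires. -/
theorem IsSmoothLagrangian.hasFDerivAt (hF : IsSmoothLagrangian S F) {t : ℝ} (ht : t ∈ S)
    (q : ℝ × ℝ) :
    HasFDerivAt (fun q : ℝ × ℝ => F t q.1 q.2)
      (partial2 F t q.1 q.2 • ContinuousLinearMap.fst ℝ ℝ ℝ +
        partial3 F t q.1 q.2 • ContinuousLinearMap.snd ℝ ℝ ℝ) q := by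
  have c2 := continuous_slice hF.continuousOn2 ht
  have c3 := continuous_slice hF.continuousOn3 ht
  have := hasStrictFDerivAt_uncurry_coprod (𝕜 := ℝ) (u := q) (f := F t)
    (f₁ := fun x v => ContinuousLinearMap.toSpanSingleton ℝ (partial2 F t x v))
    (f₂ := fun x v => ContinuousLinearMap.toSpanSingleton ℝ (partial3 F t x v))
    (Eventually.of_forall fun p => (hF.differentiable2 t ht p.2 p.1).hasDerivAt.hasFDerivAt)
    (Eventually.of_forall fun p => (hF.differentiable3 t ht p.1 p.2).hasDerivAt.hasFDerivAt)
    (((ContinuousLinearMap.toSpanSingletonLIE ℝ ℝ).continuous.comp c2).continuousAt)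
    (((ContinuousLinearMap.toSpanSingletonLIE ℝ ℝ).continuous.comp c3).continuousAt)
  refine this.hasFDerivAt.congr_fderiv ?_
  ext <;> simp [Function.HasUncurry.uncurry]

end Slice

/-! ### Differentiation under the integral sign. -/

section Parametric

variable {V : Type*} [NormedAddCommGroup V] [NormedSpace ℝ V]

/-- `A` and `B` are the linear perturbations of the `x` and `v` slots. On the unit ball the
arguments stay in a compact set, so the derivatives `D` are uniformly bounded. Domination gives
differentiability near 0 and continuity of the derivative at 0, hence the strict derivative that the
multiplier rule needs. -/
theorem exists_hasStrictFDerivAt_integral_lagrangian {S K : Set ℝ} (hS : IsClosed S) (hK : IsCompact K)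
    (hKS : K ⊆ S) {F : ℝ → ℝ → ℝ → ℝ} (hF : IsSmoothLagrangian S F) {μ : Measure ℝ}
    [IsFiniteMeasure μ] (hμ : ∀ᵐ t ∂μ, t ∈ K) {u v : ℝ → ℝ} {A B : ℝ → V →L[ℝ] ℝ}
    (hu : AEMeasurable u μ) (hv : AEMeasurable v μ) (hA : AEStronglyMeasurable A μ)
    (hB : AEStronglyMeasurable B μ) {M : ℝ} (hub : ∀ t ∈ K, |u t| ≤ M) (hvb : ∀ t ∈ K, |v t| ≤ M)
    (hAb : ∀ t ∈ K, ‖A t‖ ≤ M) (hBb : ∀ t ∈ K, ‖B t‖ ≤ M) :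
    ∃ Φ : V →L[ℝ] ℝ, HasStrictFDerivAt (fun p : V => ∫ t, F t (u t + A t p) (v t + B t p) ∂μ) Φ 0 ∧
      ∀ q, Φ q = ∫ t, (partial2 F t (u t) (v t) * A t q + partial3 F t (u t) (v t) * B t q) ∂μ := by
  set D : V → ℝ → V →L[ℝ] ℝ := fun p t =>
    partial2 F t (u t + A t p) (v t + B t p) • A t +
      partial3 F t (u t + A t p) (v t + B t p) • B t with hD
  have hμS : ∀ᵐ t ∂μ, t ∈ S := hμ.mono fun _ ht => hKS ht
  have hup : ∀ p, AEMeasurable (fun t => u t + A t p) μ := fun p =>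
    hu.add (hA.apply_continuousLinearMap p).aemeasurable
  have hvp : ∀ p, AEMeasurable (fun t => v t + B t p) μ := fun p =>
    hv.add (hB.apply_continuousLinearMap p).aemeasurable
  have hball : ∀ p ∈ Metric.ball (0 : V) 1, ∀ t ∈ K,
      |u t + A t p| ≤ 2 * M ∧ |v t + B t p| ≤ 2 * M := by
    intro p hp t ht
    have hp1 : ‖p‖ ≤ 1 := (mem_ball_zero_iff.1 hp).le
    have hb : ∀ {c : ℝ} {C : V →L[ℝ] ℝ}, |c| ≤ M → ‖C‖ ≤ M → |c + C p| ≤ 2 * M := by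
      intro c C hc hC
      have h1 := C.le_of_opNorm_le_of_le hC hp1
      rw [Real.norm_eq_abs] at h1
      linarith [abs_add_le c (C p)]
    exact ⟨hb (hub t ht) (hAb t ht), hb (hvb t ht) (hBb t ht)⟩
  obtain ⟨C, hC⟩ := exists_bound_of_continuousOn hK hKS hF.continuousOn (2 * M)
  obtain ⟨C₂, hC₂⟩ := exists_bound_of_continuousOn hK hKS hF.continuousOn2 (2 * M)
  obtain ⟨C₃, hC₃⟩ := exists_bound_of_continuousOn hK hKS hF.continuousOn3 (2 * M)
  have hDm : ∀ p, AEStronglyMeasurable (D p) μ := fun p =>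
    ((aestronglyMeasurable_comp hS hF.continuousOn2 hμS (hup p) (hvp p)).smul hA).add
      ((aestronglyMeasurable_comp hS hF.continuousOn3 hμS (hup p) (hvp p)).smul hB)
  have hDb : ∀ᵐ t ∂μ, ∀ p ∈ Metric.ball (0 : V) 1, ‖D p t‖ ≤ C₂ * M + C₃ * M := by
    filter_upwards [hμ] with t ht p hp
    obtain ⟨h1, h2⟩ := hball p hp t ht
    have e2 := hC₂ t ht _ _ h1 h2
    have e3 := hC₃ t ht _ _ h1 h2
    refine (norm_add_le _ _).trans (add_le_add ?_ ?_)
    · rw [norm_smul]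
      exact mul_le_mul e2 (hAb t ht) (norm_nonneg _) ((abs_nonneg _).trans e2)
    · rw [norm_smul]
      exact mul_le_mul e3 (hBb t ht) (norm_nonneg _) ((abs_nonneg _).trans e3)
  have hderiv : ∀ t ∈ S, ∀ p, HasFDerivAt (fun p => F t (u t + A t p) (v t + B t p)) (D p t) p := by
    intro t ht p
    have h1 : HasFDerivAt (fun p => (u t + A t p, v t + B t p)) ((A t).prod (B t)) p :=
      ((A t).hasFDerivAt.const_add _).prodMk ((B t).hasFDerivAt.const_add _)
    refine ((hF.hasFDerivAt ht (u t + A t p, v t + B t p)).comp p h1).congr_fderiv ?_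
    ext q
    simp [hD]
  have hDi : Integrable (D 0) μ := Integrable.of_bound (hDm 0) (C₂ * M + C₃ * M)
    (hDb.mono fun t ht => ht 0 (Metric.mem_ball_self one_pos))
  refine ⟨∫ t, D 0 t ∂μ, ?_, fun q => ?_⟩
  swap
  · rw [ContinuousLinearMap.integral_apply hDi]
    simp [hD]
  refine hasStrictFDerivAt_of_hasFDerivAt_of_continuousAt (f' := fun p => ∫ t, D p t ∂μ) ?_ ?_
  · filter_upwards [Metric.ball_mem_nhds (0 : V) one_pos] with p hp
    refine hasFDerivAt_integral_of_dominated_of_fderiv_le (Metric.isOpen_ball.mem_nhds hp)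
      (Eventually.of_forall fun q =>
        aestronglyMeasurable_comp hS hF.continuousOn hμS (hup q) (hvp q)) ?_ (hDm p) hDb
      (integrable_const _) (hμS.mono fun t ht q _ => hderiv t ht q)
    refine Integrable.of_bound (aestronglyMeasurable_comp hS hF.continuousOn hμS (hup p) (hvp p))
      C (hμ.mono fun t ht => ?_)
    obtain ⟨h1, h2⟩ := hball p hp t ht
    exact hC t ht _ _ h1 h2
  · refine continuousAt_of_dominated (bound := fun _ => C₂ * M + C₃ * M)
      (Eventually.of_forall hDm) ?_ (integrable_const _) (hμS.mono fun t ht => ?_)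
    · filter_upwards [Metric.ball_mem_nhds (0 : V) one_pos] with p hp
      exact hDb.mono fun t ht => ht p hp
    · have c0 : Continuous fun p => (u t + A t p, v t + B t p) := by fun_prop
      exact ((((continuous_slice hF.continuousOn2 ht).comp c0).smul continuous_const).add
        (((continuous_slice hF.continuousOn3 ht).comp c0).smul continuous_const)).continuousAt

end Parametric

/-! ### Integration by parts and the du Bois-Reymond lemma. -/

theorem deltaIntegral_eq (S : Set ℝ) (a : ℝ) {b t : ℝ} (f : ℝ → ℝ) (htb : t ≤ b) :
    deltaIntegral S f a t =
      ∫ s, (if s < t then f s else 0) ∂(deltaMeasure S).restrict (Ico a b) := by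
  have e : (fun s => if s < t then f s else 0) = (Iio t).indicator f := by
    ext s; simp [indicator]
  rw [e, integral_indicator measurableSet_Iio, Measure.restrict_restrict measurableSet_Iio,
    deltaIntegral]
  congr 2
  ext s
  simp only [mem_Ico, mem_inter_iff, mem_Iio]
  constructor
  · rintro ⟨h1, h2⟩
    exact ⟨h2, h1, h2.trans_le htb⟩
  · rintro ⟨h1, h2, -⟩
    exact ⟨h2, h1⟩

namespace IsCompactScale

variable {S : Set ℝ} {a b : ℝ} (h : IsCompactScale S a b)
include h

theorem measure_singleton_of_sigma_eq {t : ℝ} (ht : t ∈ S) (htb : t < b) (hst : sigma S t = t) :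
    deltaMeasure S {t} = 0 := by
  refine le_antisymm (ENNReal.le_of_forall_pos_le_add fun ε hε _ => ?_) zero_le
  obtain ⟨s, hs, h1, h2⟩ := exists_lt_of_sigma_lt (x := t + ε) h.right_mem htb
    (by rw [hst]; simpa using hε)
  calc deltaMeasure S {t} ≤ deltaMeasure S (Ico t s) :=
        measure_mono (singleton_subset_iff.2 ⟨le_rfl, h1⟩)
    _ = ENNReal.ofReal (s - t) := deltaMeasure_Ico h.isClosed ht hs
    _ ≤ ENNReal.ofReal ε := ENNReal.ofReal_le_ofReal (by linarith)
    _ = 0 + ε := by rw [zero_add, ENNReal.ofReal_coe_nnreal]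

/-- If `t` is right-scattered, its atom lies in [a, σ(t)); if `t` is right-dense, {t} is null and
may be included. The contrast between s ≤ t here and s < t in `deltaIntegral_eq` accounts for the
`σ` in integration by parts. -/
theorem deltaIntegral_sigma_eq {f : ℝ → ℝ} {t : ℝ} (ht : t ∈ S) (htb : t < b) :
    deltaIntegral S f a (sigma S t) =
      ∫ s, (if s ≤ t then f s else 0) ∂(deltaMeasure S).restrict (Ico a b) := by
  have e : (fun s => if s ≤ t then f s else 0) = (Iic t).indicator f := by
    ext s; simp [indicator]
  rw [e, integral_indicator measurableSet_Iic, Measure.restrict_restrict measurableSet_Iic,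
    deltaIntegral]
  refine setIntegral_congr_set ?_
  have h1 : ∀ᵐ s ∂(deltaMeasure S), s ∈ S := deltaMeasure_compl h.isClosed
  have h2 : ∀ᵐ s ∂(deltaMeasure S), sigma S t = t → s ≠ t := by
    by_cases hst : sigma S t = t
    · have h3 : ∀ᵐ s ∂(deltaMeasure S), s ∉ ({t} : Set ℝ) :=
        measure_eq_zero_iff_ae_notMem.1 (h.measure_singleton_of_sigma_eq ht htb hst)
      filter_upwards [h3] with s hs _ using hs
    · exact Eventually.of_forall fun s hs => absurd hs hst
  filter_upwards [h1, h2] with s hs hne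
  refine propext (show s ∈ Ico a (sigma S t) ↔ s ∈ Iic t ∩ Ico a b from ?_)
  constructor
  · rintro ⟨h3, h4⟩
    have h5 : s ≤ t := by
      by_contra! hh
      exact absurd (sigma_le hs hh) (not_le.2 h4)
    exact ⟨h5, h3, h5.trans_lt htb⟩
  · rintro ⟨h3 : s ≤ t, h4, -⟩
    refine ⟨h4, ?_⟩
    rcases (le_sigma S t).eq_or_lt with he | hlt
    · rw [← he]
      exact lt_of_le_of_ne h3 (hne he.symm)
    · exact h3.trans_lt hlt

/-- Integration by parts for the delta integral, for two functions given as integrals. -/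
theorem integral_mul_sigma_add_integral_mul {f w : ℝ → ℝ}
    (hf : IntegrableOn f (Ico a b) (deltaMeasure S))
    (hw : IntegrableOn w (Ico a b) (deltaMeasure S)) :
    ∫ t in Ico a b, f t * deltaIntegral S w a (sigma S t) ∂(deltaMeasure S) +
      ∫ t in Ico a b, deltaIntegral S f a t * w t ∂(deltaMeasure S) =
      deltaIntegral S f a b * deltaIntegral S w a b := by
  have hfin := h.isFiniteMeasure
  rw [IntegrableOn] at hf hw
  set μ := (deltaMeasure S).restrict (Ico a b) with hμ
  have hK : Integrable (fun p : ℝ × ℝ => f p.1 * w p.2) (μ.prod μ) := hf.mul_prod hw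
  -- The regions p.2 ≤ p.1 and p.1 < p.2 partition the square, diagonal included, so the two
  -- iterated integrals add up to the product.
  have hU : Integrable (fun p : ℝ × ℝ => if p.2 ≤ p.1 then f p.1 * w p.2 else 0) (μ.prod μ) := by
    convert! hK.indicator (measurableSet_le measurable_snd measurable_fst) using 1
  have hV : Integrable (fun p : ℝ × ℝ => if p.1 < p.2 then f p.1 * w p.2 else 0) (μ.prod μ) := by
    convert! hK.indicator (measurableSet_lt measurable_fst measurable_snd) using 1
  have e1 : ∫ t, f t * deltaIntegral S w a (sigma S t) ∂μ =
      ∫ p : ℝ × ℝ, (if p.2 ≤ p.1 then f p.1 * w p.2 else 0) ∂(μ.prod μ) := by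
    rw [integral_prod _ hU]
    refine integral_congr_ae ?_
    filter_upwards [h.ae_mem] with t ht
    rw [h.deltaIntegral_sigma_eq ht.1 ht.2.2, ← integral_const_mul]
    simp only [mul_ite, mul_zero]
    rfl
  have e2 : ∫ t, deltaIntegral S f a t * w t ∂μ =
      ∫ p : ℝ × ℝ, (if p.1 < p.2 then f p.1 * w p.2 else 0) ∂(μ.prod μ) := by
    rw [integral_prod_symm _ hV]
    refine integral_congr_ae ?_
    filter_upwards [h.ae_mem] with t ht
    rw [deltaIntegral_eq _ _ _ ht.2.2.le, ← integral_mul_const]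
    simp only [ite_mul, zero_mul]
    rfl
  rw [e1, e2, ← integral_add hU hV, deltaIntegral, deltaIntegral, ← hμ, ← integral_prod_mul]
  refine integral_congr_ae (Eventually.of_forall fun p => ?_)
  rcases le_or_gt p.2 p.1 with hle | hlt
  · simp [hle, not_lt.2 hle]
  · simp [hlt, not_le.2 hlt]

theorem exists_mem_of_ae {p : ℝ → Prop}
    (hp : ∀ᵐ t ∂(deltaMeasure S).restrict (Ico a b), p t) {c d : ℝ} (hc : c ∈ S) (hd : d ∈ S)
    (hcd : c < d) : ∃ t ∈ S, c ≤ t ∧ t < d ∧ p t := by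
  have h1 : ∀ᵐ t ∂(deltaMeasure S).restrict (Ico c d), p t ∧ t ∈ S :=
    (ae_restrict_of_ae_restrict_of_subset (Ico_subset_Ico (h.subset hc).1 (h.subset hd).2)
      (hp.and (h.ae_mem.mono fun _ ht => ht.1)))
  have hne : (deltaMeasure S).restrict (Ico c d) ≠ 0 := by
    rw [Ne, Measure.restrict_eq_zero, deltaMeasure_Ico h.isClosed hc hd, ENNReal.ofReal_eq_zero]
    linarith
  have := ae_neBot.2 hne
  obtain ⟨t, ⟨h2, h3⟩, h4⟩ := (h1.and (ae_restrict_mem measurableSet_Ico)).exists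
  exact ⟨t, h3, h4.1, h4.2, h2⟩

/-- A function that is continuous at right-dense points and a.e. constant is constant on `S^κ`. -/
theorem eq_of_ae_eq {E : ℝ → ℝ} {c : ℝ}
    (hE : ∀ᵐ t ∂(deltaMeasure S).restrict (Ico a b), E t = c)
    (hcont : ∀ t ∈ upperKappa S, sigma S t = t → ContinuousWithinAt E (upperKappa S) t)
    {t : ℝ} (ht : t ∈ upperKappa S) : E t = c := by
  rcases (le_sigma S t).eq_or_lt with he | hlt
  · by_contra hne
    obtain ⟨δ, hδ, hc⟩ := Metric.continuousWithinAt_iff.1 (hcont t ht he.symm) |E t - c|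
      (abs_pos.2 (sub_ne_zero.2 hne))
    have key : ∀ s ∈ S, s < b → |s - t| < δ → E s ≠ c := fun s hs hsb hst heq => by
      have := hc (h.mem_upperKappa hs hsb) hst
      rw [heq, Real.dist_eq, abs_sub_comm] at this
      exact lt_irrefl _ this
    -- Scale intervals of positive mass arbitrarily near `t` lie to its right if t < b. If t = b,
    -- membership in `S^κ` makes `b` left-dense, and they lie to its left.
    rcases (h.subset ht.1).2.eq_or_lt with rfl | htb
    · obtain ⟨s, hs, h1, h2⟩ := h.exists_mem_Ioo_of_right_mem ht (show t - δ < t by linarith)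
      obtain ⟨r, hr, h3, h4, h5⟩ := h.exists_mem_of_ae hE hs h.right_mem h2
      exact key r hr h4 (by rw [abs_lt]; constructor <;> linarith) h5
    · obtain ⟨s, hs, h1, h2⟩ := exists_lt_of_sigma_lt (x := t + δ) h.right_mem htb (by linarith)
      obtain ⟨r, hr, h3, h4, h5⟩ := h.exists_mem_of_ae hE ht.1 hs h1
      exact key r hr (h4.trans_le (h.subset hs).2)
        (by rw [abs_lt]; constructor <;> linarith) h5
  -- A right-scattered `t` is an atom, so an almost-everywhere statement holds at `t` itself.
  · obtain ⟨s, hs, h1, h2, h3⟩ := h.exists_mem_of_ae hE ht.1 (h.sigma_mem ht.1) hlt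
    have : s = t := by
      by_contra hne
      exact absurd (sigma_le hs (lt_of_le_of_ne h1 (Ne.symm hne))) (not_le.2 h2)
    rwa [← this]

theorem integrableOn_of_continuous {w : ℝ → ℝ} (hw : Continuous w) :
    IntegrableOn w (Ico a b) (deltaMeasure S) := by
  have := h.isFiniteMeasure
  obtain ⟨C, hC⟩ := h.isCompact.exists_bound_of_continuousOn hw.continuousOn
  refine Integrable.of_bound hw.aestronglyMeasurable C ?_
  filter_upwards [h.ae_mem] with t ht using hC t ht.1

end IsCompactScale

/-- The du Bois-Reymond lemma for a finite measure. -/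
theorem exists_ae_eq_const_of_integral_mul_eq_zero {μ : Measure ℝ} [IsFiniteMeasure μ]
    (hμ : μ ≠ 0) {E : ℝ → ℝ} (hE : Integrable E μ)
    (h0 : ∀ w : ℝ → ℝ, Continuous w → ∫ t, w t ∂μ = 0 → ∫ t, E t * w t ∂μ = 0) :
    ∃ c, ∀ᵐ t ∂μ, E t = c := by
  have hm : μ.real univ ≠ 0 := by simpa [Measure.real, ENNReal.toReal_eq_zero_iff] using hμ
  set c := (∫ t, E t ∂μ) / μ.real univ with hc
  refine ⟨c, ?_⟩
  have hEc : Integrable (fun t => E t - c) μ := hE.sub (integrable_const c)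
  have key : ∀ᵐ t ∂μ, E t - c = 0 := by
    refine ae_eq_zero_of_integral_contDiff_smul_eq_zero hEc.locallyIntegrable fun g hg hgs => ?_
    have hgc := hg.continuous
    have hgi : Integrable g μ := hgc.integrable_of_hasCompactSupport hgs
    obtain ⟨C, hC⟩ := hgs.exists_bound_of_continuous hgc
    have hEg : Integrable (fun t => E t * g t) μ :=
      hE.mul_bdd hgc.aestronglyMeasurable (Eventually.of_forall hC)
    -- Subtracting its mean makes `g` an allowed test function; E - c against `g` equals E against g
    -- - m.
    set m := (∫ t, g t ∂μ) / μ.real univ with hmdef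
    have e1 := h0 (fun t => g t - m) (hgc.sub continuous_const) (by
      rw [integral_sub hgi (integrable_const m), integral_const, smul_eq_mul, hmdef]
      field_simp
      ring)
    simp only [mul_sub] at e1
    rw [integral_sub hEg (hE.mul_const m), integral_mul_const] at e1
    simp only [smul_eq_mul, mul_sub]
    rw [integral_sub (by simpa only [mul_comm] using hEg) (hgi.mul_const c), integral_mul_const]
    simp only [mul_comm (g _)]
    rw [sub_eq_zero.1 e1, hmdef, hc]
    ring
  filter_upwards [key] with t ht using sub_eq_zero.1 ht

/-! ### First variation and the Euler–Lagrange equation. -/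

/-- The first variation of `∫_a^b F(t, y^σ, y^Δ) Δt` in the direction `η(t) = ∫_a^t w(τ) Δτ`. -/
noncomputable def firstVariation (S : Set ℝ) (a b : ℝ) (F : ℝ → ℝ → ℝ → ℝ) (y w : ℝ → ℝ) : ℝ :=
  ∫ t in Ico a b, (along S (partial2 F) y t * deltaIntegral S w a (sigma S t) +
    along S (partial3 F) y t * w t) ∂(deltaMeasure S)

namespace IsCompactScale

variable {S : Set ℝ} {a b : ℝ} (h : IsCompactScale S a b)
include h

theorem abs_deltaIntegral_sub_deltaIntegral_le {f : ℝ → ℝ}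
    (hf : IntegrableOn f (Ico a b) (deltaMeasure S)) {C : ℝ} (hC : ∀ t ∈ upperKappa S, |f t| ≤ C)
    {s r : ℝ} (hs : s ∈ S) (hr : r ∈ S) :
    |deltaIntegral S f a s - deltaIntegral S f a r| ≤ C * |s - r| := by
  wlog hle : r ≤ s generalizing s r
  · rw [abs_sub_comm, abs_sub_comm s r]
    exact this hr hs (le_of_not_ge hle)
  rw [h.deltaIntegral_sub hf hr hs hle, abs_of_nonneg (sub_nonneg.2 hle)]
  simpa using h.abs_deltaIntegral_sub_le (k := 0) (C := C) hf hr hs hle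
    fun t ht _ h2 => by simpa using hC t (h.mem_upperKappa ht (h2.trans_le (h.subset hs).2))

theorem continuousOn_deltaIntegral {f : ℝ → ℝ}
    (hf : IntegrableOn f (Ico a b) (deltaMeasure S)) {C : ℝ} (hC : ∀ t ∈ upperKappa S, |f t| ≤ C) :
    ContinuousOn (deltaIntegral S f a) S := by
  refine LipschitzOnWith.continuousOn (K := C.toNNReal)
    (LipschitzOnWith.of_dist_le_mul fun s hs r hr => ?_)
  rw [Real.dist_eq, Real.dist_eq]
  refine (h.abs_deltaIntegral_sub_deltaIntegral_le hf hC hs hr).trans ?_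
  gcongr
  exact Real.le_coe_toNNReal C

theorem exists_bound_of_continuous {w : ℝ → ℝ} (hw : Continuous w) :
    ∃ C, 0 ≤ C ∧ ∀ t ∈ S, |w t| ≤ C := by
  obtain ⟨C, hC⟩ := h.isCompact.exists_bound_of_continuousOn hw.continuousOn
  exact ⟨C, (abs_nonneg _).trans (hC a h.left_mem), hC⟩

theorem integrableOn_along_mul_deltaIntegral_sigma {G : ℝ → ℝ → ℝ → ℝ}
    (hG : ContinuousOn (fun p : ℝ × ℝ × ℝ => G p.1 p.2.1 p.2.2) (S ×ˢ univ)) {y : ℝ → ℝ}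
    (hy : IsC1Delta S y) {w : ℝ → ℝ} (hw : Continuous w) :
    IntegrableOn (fun t => along S G y t * deltaIntegral S w a (sigma S t)) (Ico a b)
      (deltaMeasure S) := by
  obtain ⟨C, -, hC⟩ := h.exists_bound_of_continuous hw
  have hcw := h.continuousOn_deltaIntegral (h.integrableOn_of_continuous hw) fun t ht => hC t ht.1
  obtain ⟨D, hD⟩ := h.isCompact.exists_bound_of_continuousOn hcw
  exact Integrable.mul_bdd (h.integrableOn_along hG hy)
    (h.aemeasurable_comp_sigma hcw).aestronglyMeasurable
    (h.ae_mem.mono fun t ht => hD _ (h.sigma_mem ht.1))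

theorem integrableOn_along_mul {G : ℝ → ℝ → ℝ → ℝ}
    (hG : ContinuousOn (fun p : ℝ × ℝ × ℝ => G p.1 p.2.1 p.2.2) (S ×ˢ univ)) {y : ℝ → ℝ}
    (hy : IsC1Delta S y) {w : ℝ → ℝ} (hw : Continuous w) :
    IntegrableOn (fun t => along S G y t * w t) (Ico a b) (deltaMeasure S) := by
  obtain ⟨C, -, hC⟩ := h.exists_bound_of_continuous hw
  exact Integrable.mul_bdd (h.integrableOn_along hG hy) hw.aestronglyMeasurable
    (h.ae_mem.mono fun t ht => hC t ht.1)

theorem firstVariation_sub_mul {L g : ℝ → ℝ → ℝ → ℝ} (hL : IsSmoothLagrangian S L)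
    (hg : IsSmoothLagrangian S g) (k : ℝ) {y : ℝ → ℝ} (hy : IsC1Delta S y) {w : ℝ → ℝ}
    (hw : Continuous w) :
    firstVariation S a b (fun t x v => L t x v - k * g t x v) y w =
      firstVariation S a b L y w - k * firstVariation S a b g y w := by
  have iL := (h.integrableOn_along_mul_deltaIntegral_sigma hL.continuousOn2 hy hw).add
    (h.integrableOn_along_mul hL.continuousOn3 hy hw)
  have ig := (h.integrableOn_along_mul_deltaIntegral_sigma hg.continuousOn2 hy hw).add
    (h.integrableOn_along_mul hg.continuousOn3 hy hw)
  refine Eq.trans (integral_congr_ae ?_) ((integral_sub iL (ig.const_mul k)).trans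
    (congrArg _ (integral_const_mul k _)))
  filter_upwards [h.ae_mem] with t ht
  simp only [along, partial2_sub_mul hL hg k ht.1, partial3_sub_mul hL hg k ht.1, Pi.add_apply]
  ring

/-- Integration by parts moves ∂₂F onto `w`; the boundary term vanishes by `hw0`. -/
theorem firstVariation_eq {F : ℝ → ℝ → ℝ → ℝ} (hF : IsSmoothLagrangian S F) {y : ℝ → ℝ}
    (hy : IsC1Delta S y) {w : ℝ → ℝ} (hw : Continuous w) (hw0 : deltaIntegral S w a b = 0) :
    firstVariation S a b F y w =
      ∫ t in Ico a b, eulerLagrangeExpr S a F y t * w t ∂(deltaMeasure S) := by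
  have hfin := h.isFiniteMeasure
  obtain ⟨C₂, hC₂⟩ := h.exists_bound_along hF.continuousOn2 hy
  have hwi := h.integrableOn_of_continuous hw
  have i2 := h.integrableOn_along hF.continuousOn2 hy
  have i3 := h.integrableOn_along hF.continuousOn3 hy
  have hcf := h.continuousOn_deltaIntegral i2 hC₂
  obtain ⟨D', hD'⟩ := h.isCompact.exists_bound_of_continuousOn hcf
  have j1 := h.integrableOn_along_mul_deltaIntegral_sigma hF.continuousOn2 hy hw
  have j2 := h.integrableOn_along_mul hF.continuousOn3 hy hw
  have j3 : IntegrableOn (fun t => deltaIntegral S (along S (partial2 F) y) a t * w t) (Ico a b)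
      (deltaMeasure S) :=
    Integrable.bdd_mul hwi
      (h.aemeasurable_of_continuousOn (hcf.mono sdiff_subset)).aestronglyMeasurable
      (h.ae_mem.mono fun t ht => hD' _ ht.1)
  have hparts := h.integral_mul_sigma_add_integral_mul i2 hwi
  rw [hw0, mul_zero] at hparts
  simp only [eulerLagrangeExpr, sub_mul]
  rw [firstVariation, integral_add j1 j2, integral_sub j2 j3]
  linarith

/-- If the first variation vanishes in all directions that keep the boundary values, then the
integral Euler–Lagrange equation holds on `S^κ`. -/
theorem exists_eulerLagrangeExpr_eq {F : ℝ → ℝ → ℝ → ℝ} (hF : IsSmoothLagrangian S F) {y : ℝ → ℝ}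
    (hy : IsC1Delta S y)
    (h0 : ∀ w : ℝ → ℝ, Continuous w → deltaIntegral S w a b = 0 → firstVariation S a b F y w = 0) :
    ∃ c, ∀ t ∈ upperKappa S, eulerLagrangeExpr S a F y t = c := by
  have hfin := h.isFiniteMeasure
  obtain ⟨C₂, hC₂⟩ := h.exists_bound_along hF.continuousOn2 hy
  have i2 := h.integrableOn_along hF.continuousOn2 hy
  have i3 := h.integrableOn_along hF.continuousOn3 hy
  have hcf := h.continuousOn_deltaIntegral i2 hC₂
  obtain ⟨D', hD'⟩ := h.isCompact.exists_bound_of_continuousOn hcf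
  have hE : IntegrableOn (eulerLagrangeExpr S a F y) (Ico a b) (deltaMeasure S) :=
    Integrable.sub i3 (Integrable.of_bound
      (h.aemeasurable_of_continuousOn (hcf.mono sdiff_subset)).aestronglyMeasurable D'
      (h.ae_mem.mono fun t ht => hD' _ ht.1))
  have hne : (deltaMeasure S).restrict (Ico a b) ≠ 0 := by
    rw [Ne, Measure.restrict_eq_zero, deltaMeasure_Ico h.isClosed h.left_mem h.right_mem,
      ENNReal.ofReal_eq_zero]
    linarith [h.lt]
  obtain ⟨c, hc⟩ := exists_ae_eq_const_of_integral_mul_eq_zero hne hE fun w hw hw0 => by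
    rw [← h.firstVariation_eq hF hy hw hw0]
    exact h0 w hw hw0
  refine ⟨c, fun t ht => h.eq_of_ae_eq hc (fun s hs hss => ?_) ht⟩
  exact (h.continuousWithinAt_along hF.continuousOn3 hy hs hss).sub
    ((hcf s hs.1).mono sdiff_subset)

/-- The half of `IsExtremal` at ρ(t) follows from the other half, because `ρ` maps `S_κ` into `S^κ`.
-/
theorem isExtremal_of_firstVariation_eq_zero {F : ℝ → ℝ → ℝ → ℝ} (hF : IsSmoothLagrangian S F)
    {y : ℝ → ℝ} (hy : IsC1Delta S y)
    (h0 : ∀ w : ℝ → ℝ, Continuous w → deltaIntegral S w a b = 0 → firstVariation S a b F y w = 0) :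
    IsExtremal S a F y := by
  obtain ⟨c, hc⟩ := h.exists_eulerLagrangeExpr_eq hF hy h0
  exact ⟨⟨c, fun t ht => hc _ (h.rho_mem_upperKappa ht)⟩, c, hc⟩

/-- The delta derivative form of the Euler–Lagrange equation follows from the integral form. -/
theorem hasDeltaDerivAt_of_eulerLagrangeExpr_eq {F : ℝ → ℝ → ℝ → ℝ}
    (hF : IsSmoothLagrangian S F) {y : ℝ → ℝ} (hy : IsC1Delta S y) {c : ℝ}
    (hc : ∀ t ∈ upperKappa S, eulerLagrangeExpr S a F y t = c) {t : ℝ}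
    (ht : t ∈ upperKappa (upperKappa S)) (hst : sigma S t ∈ upperKappa S) :
    HasDeltaDerivAt (upperKappa S) (along S (partial3 F) y) (along S (partial2 F) y t) t := by
  obtain ⟨C, hC⟩ := h.exists_bound_along hF.continuousOn2 hy
  -- On `S^κ`, ∂₃F is c + ∫_a^t ∂₂F; the integral is differentiated on `S` and the result
  -- restricted.
  refine (h.hasDeltaDerivAt_deltaIntegral (h.integrableOn_along hF.continuousOn2 hy) hC ht.1.1
    (h.continuousWithinAt_along hF.continuousOn2 hy ht.1)).congr_of_subset (k := c) sdiff_subset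
    (h.sigma_upperKappa hst) hst fun s hs => ?_
  rw [← hc s hs, eulerLagrangeExpr]
  ring

end IsCompactScale

/-! ### Two-parameter variations. -/

/-- The two-parameter variation of `y` in the directions `∫_a^t w Δτ` and `∫_a^t z Δτ`. -/
noncomputable def variation (S : Set ℝ) (a : ℝ) (y w z : ℝ → ℝ) (p : ℝ × ℝ) (t : ℝ) : ℝ :=
  y t + (p.1 * deltaIntegral S w a t + p.2 * deltaIntegral S z a t)

theorem deltaIntegral_self (S : Set ℝ) (f : ℝ → ℝ) (a : ℝ) : deltaIntegral S f a a = 0 := by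
  simp [deltaIntegral]

namespace IsCompactScale

variable {S : Set ℝ} {a b : ℝ} (h : IsCompactScale S a b) {w z : ℝ → ℝ} (hw : Continuous w)
  (hz : Continuous z)
include h hw

theorem hasDeltaDerivAt_of_continuous {t : ℝ} (ht : t ∈ S) :
    HasDeltaDerivAt S (deltaIntegral S w a) (w t) t := by
  obtain ⟨C, -, hC⟩ := h.exists_bound_of_continuous hw
  exact h.hasDeltaDerivAt_deltaIntegral (h.integrableOn_of_continuous hw) (fun t ht => hC t ht.1)
    ht fun _ => hw.continuousWithinAt

include hz

theorem hasDeltaDerivAt_perturbation (p : ℝ × ℝ) {t : ℝ} (ht : t ∈ S) :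
    HasDeltaDerivAt S (fun t => p.1 * deltaIntegral S w a t + p.2 * deltaIntegral S z a t)
      (p.1 * w t + p.2 * z t) t :=
  ((h.hasDeltaDerivAt_of_continuous hw ht).const_mul p.1).add
    ((h.hasDeltaDerivAt_of_continuous hz ht).const_mul p.2)

theorem eventually_c1Norm_variation_lt (y : ℝ → ℝ) {δ : ℝ} (hδ : 0 < δ) :
    ∀ᶠ p in 𝓝 (0 : ℝ × ℝ),
      c1Norm S (fun t => variation S a y w z p t - y t) < ENNReal.ofReal δ := by
  obtain ⟨C₁, h1, hC₁⟩ := h.exists_bound_of_continuous hw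
  obtain ⟨C₂, h2, hC₂⟩ := h.exists_bound_of_continuous hz
  have hab := h.lt
  -- With k = |p.1| C₁ + |p.2| C₂, slopes are at most k and values at most k(b - a); k(b - a + 1)
  -- dominates both, and the norm has four terms.
  have hc : Continuous fun p : ℝ × ℝ => 4 * ((|p.1| * C₁ + |p.2| * C₂) * (b - a + 1)) := by
    fun_prop
  have hev : ∀ᶠ p in 𝓝 (0 : ℝ × ℝ), 4 * ((|p.1| * C₁ + |p.2| * C₂) * (b - a + 1)) < δ :=
    hc.continuousAt.eventually_lt_const (by simpa using hδ)
  filter_upwards [hev] with p hp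
  have hk : 0 ≤ |p.1| * C₁ + |p.2| * C₂ := by positivity
  have hlip : ∀ s ∈ S, ∀ r ∈ S,
      |p.1 * deltaIntegral S w a s + p.2 * deltaIntegral S z a s -
        (p.1 * deltaIntegral S w a r + p.2 * deltaIntegral S z a r)| ≤
      (|p.1| * C₁ + |p.2| * C₂) * |s - r| := by
    intro s hs r hr
    have e1 := h.abs_deltaIntegral_sub_deltaIntegral_le (h.integrableOn_of_continuous hw)
      (fun t ht => hC₁ t ht.1) hs hr
    have e2 := h.abs_deltaIntegral_sub_deltaIntegral_le (h.integrableOn_of_continuous hz)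
      (fun t ht => hC₂ t ht.1) hs hr
    calc _ = |p.1 * (deltaIntegral S w a s - deltaIntegral S w a r) +
          p.2 * (deltaIntegral S z a s - deltaIntegral S z a r)| := by ring_nf
      _ ≤ |p.1| * (C₁ * |s - r|) + |p.2| * (C₂ * |s - r|) := by
          refine (abs_add_le _ _).trans ?_
          rw [abs_mul, abs_mul]
          gcongr
      _ = _ := by ring
  refine lt_of_le_of_lt ?_ ((ENNReal.ofReal_lt_ofReal_iff hδ).2 hp)
  simp only [variation, add_sub_cancel_left]
  refine h.c1Norm_le (by nlinarith) (fun s hs => ?_) (fun s hs r hr => ?_) fun t ht => ?_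
  · have e := hlip s hs a h.left_mem
    rw [deltaIntegral_self, deltaIntegral_self, mul_zero, mul_zero, add_zero, sub_zero,
      abs_of_nonneg (sub_nonneg.2 (h.subset hs).1)] at e
    refine e.trans ?_
    gcongr
    linarith [(h.subset hs).2]
  · refine (hlip s hs r hr).trans ?_
    gcongr
    nlinarith
  · rw [h.deltaDeriv_eq ht (h.hasDeltaDerivAt_perturbation hw hz p ht.1)]
    refine (abs_add_le _ _).trans ?_
    rw [abs_mul, abs_mul]
    have e1 := mul_le_mul_of_nonneg_left (hC₁ t ht.1) (abs_nonneg p.1)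
    have e2 := mul_le_mul_of_nonneg_left (hC₂ t ht.1) (abs_nonneg p.2)
    nlinarith

variable {y : ℝ → ℝ} (hy : IsC1Delta S y)
include hy

theorem hasDeltaDerivAt_variation (p : ℝ × ℝ) {t : ℝ} (ht : t ∈ upperKappa S) :
    HasDeltaDerivAt S (variation S a y w z p) (deltaDeriv S y t + (p.1 * w t + p.2 * z t)) t := by
  obtain ⟨c, hc⟩ := hy.1 t ht
  rw [h.deltaDeriv_eq ht hc]
  exact hc.add (h.hasDeltaDerivAt_perturbation hw hz p ht.1)

theorem deltaDeriv_variation (p : ℝ × ℝ) {t : ℝ} (ht : t ∈ upperKappa S) :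
    deltaDeriv S (variation S a y w z p) t = deltaDeriv S y t + (p.1 * w t + p.2 * z t) :=
  h.deltaDeriv_eq ht (h.hasDeltaDerivAt_variation hw hz hy p ht)

theorem isC1Delta_variation (p : ℝ × ℝ) : IsC1Delta S (variation S a y w z p) := by
  refine ⟨fun t ht => ⟨_, h.hasDeltaDerivAt_variation hw hz hy p ht⟩, ?_⟩
  refine ContinuousOn.congr (hy.2.add ?_) fun t ht => h.deltaDeriv_variation hw hz hy p ht
  exact Continuous.continuousOn (by fun_prop)

theorem exists_hasStrictFDerivAt_functional_variation {F : ℝ → ℝ → ℝ → ℝ}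
    (hF : IsSmoothLagrangian S F) :
    ∃ Φ : ℝ × ℝ →L[ℝ] ℝ,
      HasStrictFDerivAt (fun p => functional S a b F (variation S a y w z p)) Φ 0 ∧
      Φ (1, 0) = firstVariation S a b F y w ∧ Φ (0, 1) = firstVariation S a b F y z := by
  have hfin := h.isFiniteMeasure
  obtain ⟨M, hM₁, hM₂⟩ := h.exists_bound_isC1Delta hy
  obtain ⟨C₁, h1, hC₁⟩ := h.exists_bound_of_continuous hw
  obtain ⟨C₂, h2, hC₂⟩ := h.exists_bound_of_continuous hz
  have hcw := h.continuousOn_deltaIntegral (h.integrableOn_of_continuous hw) fun t ht => hC₁ t ht.1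
  have hcz := h.continuousOn_deltaIntegral (h.integrableOn_of_continuous hz) fun t ht => hC₂ t ht.1
  obtain ⟨D₁, hD₁⟩ := h.isCompact.exists_bound_of_continuousOn hcw
  obtain ⟨D₂, hD₂⟩ := h.isCompact.exists_bound_of_continuousOn hcz
  have hnorm : ∀ {x x' X X' : ℝ}, |x| ≤ X → |x'| ≤ X' →
      ‖x • ContinuousLinearMap.fst ℝ ℝ ℝ + x' • ContinuousLinearMap.snd ℝ ℝ ℝ‖ ≤ X + X' := by
    intro x x' X X' hx hx'
    refine (norm_add_le _ _).trans (add_le_add ?_ ?_)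
    · rw [norm_smul]
      exact (mul_le_of_le_one_right (norm_nonneg _) (ContinuousLinearMap.norm_fst_le ..)).trans hx
    · rw [norm_smul]
      exact (mul_le_of_le_one_right (norm_nonneg _) (ContinuousLinearMap.norm_snd_le ..)).trans hx'
  obtain ⟨Φ, hΦ, hΦq⟩ := exists_hasStrictFDerivAt_integral_lagrangian h.isClosed
    h.isCompact_upperKappa sdiff_subset hF (μ := (deltaMeasure S).restrict (Ico a b))
    (h.ae_mem.mono fun t ht => h.mem_upperKappa ht.1 ht.2.2)
    (u := fun t => y (sigma S t)) (v := deltaDeriv S y)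
    (A := fun t => deltaIntegral S w a (sigma S t) • ContinuousLinearMap.fst ℝ ℝ ℝ +
      deltaIntegral S z a (sigma S t) • ContinuousLinearMap.snd ℝ ℝ ℝ)
    (B := fun t => w t • ContinuousLinearMap.fst ℝ ℝ ℝ + z t • ContinuousLinearMap.snd ℝ ℝ ℝ)
    (M := max M (max (D₁ + D₂) (C₁ + C₂)))
    (h.aemeasurable_comp_sigma (h.continuousOn_of_isC1Delta hy))
    (h.aemeasurable_of_continuousOn hy.2)
    (((h.aemeasurable_comp_sigma hcw).aestronglyMeasurable.smul_const _).add
      ((h.aemeasurable_comp_sigma hcz).aestronglyMeasurable.smul_const _))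
    (Continuous.aestronglyMeasurable (by fun_prop))
    (fun t ht => (hM₁ t ht.1).trans (le_max_left _ _))
    (fun t ht => (hM₂ t ht).trans (le_max_left _ _))
    (fun t ht => (hnorm (hD₁ _ (h.sigma_mem ht.1)) (hD₂ _ (h.sigma_mem ht.1))).trans
      ((le_max_left _ _).trans (le_max_right _ _)))
    (fun t ht => (hnorm (hC₁ t ht.1) (hC₂ t ht.1)).trans
      ((le_max_right _ _).trans (le_max_right _ _)))
  refine ⟨Φ, ?_, ?_, ?_⟩
  · refine hΦ.congr_of_eventuallyEq (Eventually.of_forall fun p => Eq.symm ?_)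
    refine integral_congr_ae ?_
    filter_upwards [h.ae_mem] with t ht
    rw [along, h.deltaDeriv_variation hw hz hy p (h.mem_upperKappa ht.1 ht.2.2)]
    simp [variation, mul_comm]
  · simp [hΦq, firstVariation, along]
  · simp [hΦq, firstVariation, along]

end IsCompactScale

/-! ### The multiplier rule and the conclusion. -/

/-- The Lagrange multiplier rule for the first variations at a local minimizer, given a direction
`z` in which the first variation of the constraint does not vanish. -/
theorem IsLocalMinimizer.firstVariation_sub_mul_eq_zero {S : Set ℝ} {a b : ℝ}
    (h : IsCompactScale S a b) {L g : ℝ → ℝ → ℝ → ℝ} (hL : IsSmoothLagrangian S L)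
    (hg : IsSmoothLagrangian S g) {ya yb l : ℝ} {y : ℝ → ℝ}
    (hmin : IsLocalMinimizer S a b L g ya yb l y) {w z : ℝ → ℝ} (hw : Continuous w)
    (hz : Continuous z) (hw0 : deltaIntegral S w a b = 0) (hz0 : deltaIntegral S z a b = 0)
    (hgz : firstVariation S a b g y z ≠ 0) :
    firstVariation S a b L y w -
      firstVariation S a b L y z / firstVariation S a b g y z * firstVariation S a b g y w = 0 := by
  obtain ⟨hadm, δ, hδ, hloc⟩ := hmin
  have hy := hadm.c1
  obtain ⟨Φ, hΦ, hΦw, hΦz⟩ := h.exists_hasStrictFDerivAt_functional_variation hw hz hy hL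
  obtain ⟨Ψ, hΨ, hΨw, hΨz⟩ := h.exists_hasStrictFDerivAt_functional_variation hw hz hy hg
  have hzero : variation S a y w z 0 = y := by
    ext t
    simp [variation]
  have hext : IsLocalExtrOn (fun p => functional S a b L (variation S a y w z p))
      {p | functional S a b g (variation S a y w z p) =
        functional S a b g (variation S a y w z 0)} 0 := by
    refine Or.inl ?_
    filter_upwards [self_mem_nhdsWithin,
      nhdsWithin_le_nhds (h.eventually_c1Norm_variation_lt hw hz y hδ)] with p hp hpn
    rw [hzero]
    refine hloc _ ⟨h.isC1Delta_variation hw hz hy p, ?_, ?_, ?_⟩ hpn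
    · simp [variation, deltaIntegral_self, hadm.left]
    · simp [variation, hw0, hz0, hadm.right]
    · rw [show functional S a b g (variation S a y w z p) = _ from hp, hzero, hadm.constraint]
  obtain ⟨α, β, hne, hlin⟩ := hext.exists_multipliers_of_hasStrictFDerivAt_1d hΨ hΦ
  have ew := congrArg (fun T : ℝ × ℝ →L[ℝ] ℝ => T (1, 0)) hlin
  have ez := congrArg (fun T : ℝ × ℝ →L[ℝ] ℝ => T (0, 1)) hlin
  simp only [add_apply, smul_apply, smul_eq_mul,
    zero_apply, hΦw, hΦz, hΨw, hΨz] at ew ez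
  -- If β = 0, evaluation at (0, 1) and `hgz` give α = 0 as well, so the multipliers would be
  -- trivial.
  have hβ : β ≠ 0 := by
    rintro rfl
    rw [zero_mul, add_zero, mul_eq_zero, or_iff_left hgz] at ez
    exact hne (by rw [ez]; rfl)
  field_simp
  apply mul_left_cancel₀ hβ
  -- This combination eliminates α.
  linear_combination firstVariation S a b g y z * ew - firstVariation S a b g y w * ez

end TimeScale

theorem corollary1 (T : Set ℝ) (hT : IsClosed T) (a b : ℝ) (ha : a ∈ T) (hb : b ∈ T)
    (hab : a < b) (L g : ℝ → ℝ → ℝ → ℝ)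
    (hL : TimeScale.IsSmoothLagrangian T L) (hg : TimeScale.IsSmoothLagrangian T g)
    (ya yb l : ℝ) (y : ℝ → ℝ)
    (hmin : TimeScale.IsLocalMinimizer (T ∩ Set.Icc a b) a b L g ya yb l y)
    (hnormal : ¬ TimeScale.IsExtremal (T ∩ Set.Icc a b) a g y) :
    ∃ lam : ℝ,
      ∀ t ∈ TimeScale.upperKappa (TimeScale.upperKappa (T ∩ Set.Icc a b)),
        TimeScale.sigma (T ∩ Set.Icc a b) t ∈ TimeScale.upperKappa (T ∩ Set.Icc a b) →
          TimeScale.HasDeltaDerivAt (TimeScale.upperKappa (T ∩ Set.Icc a b))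
            (TimeScale.along (T ∩ Set.Icc a b)
              (TimeScale.partial3 (fun t x v => L t x v - lam * g t x v)) y)
            (TimeScale.along (T ∩ Set.Icc a b)
              (TimeScale.partial2 (fun t x v => L t x v - lam * g t x v)) y t)
            t := by
  have h : TimeScale.IsCompactScale (T ∩ Set.Icc a b) a b :=
    ⟨hT.inter isClosed_Icc, ⟨ha, le_rfl, hab.le⟩, ⟨hb, hab.le, le_rfl⟩, Set.inter_subset_right, hab⟩
  replace hL := hL.mono (S := T ∩ Set.Icc a b) Set.inter_subset_left
  replace hg := hg.mono (S := T ∩ Set.Icc a b) Set.inter_subset_left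
  have hy := hmin.1.c1
  -- Normality enters only here. The multiplier is then built from `z` alone, so it serves every
  -- direction `w` at once.
  have hz : ∃ z : ℝ → ℝ, Continuous z ∧ TimeScale.deltaIntegral (T ∩ Set.Icc a b) z a b = 0 ∧
      TimeScale.firstVariation (T ∩ Set.Icc a b) a b g y z ≠ 0 := by
    by_contra! hn
    exact hnormal (h.isExtremal_of_firstVariation_eq_zero hg hy hn)
  obtain ⟨z, hzc, hz0, hgz⟩ := hz
  refine ⟨TimeScale.firstVariation (T ∩ Set.Icc a b) a b L y z /
    TimeScale.firstVariation (T ∩ Set.Icc a b) a b g y z, fun t ht hst => ?_⟩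
  have hF := hL.sub_mul hg (TimeScale.firstVariation (T ∩ Set.Icc a b) a b L y z /
    TimeScale.firstVariation (T ∩ Set.Icc a b) a b g y z)
  obtain ⟨c, hc⟩ := h.exists_eulerLagrangeExpr_eq hF hy fun w hw hw0 => by
    rw [h.firstVariation_sub_mul hL hg _ hy hw]
    exact hmin.firstVariation_sub_mul_eq_zero h hL hg hw hzc hw0 hz0 hgz
  exact h.hasDeltaDerivAt_of_eulerLagrangeExpr_eq hF hy hc ht hst
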